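/- **Setting.** Let $\mathsf Z$ and $\mathsf N$ be Borel subsets of finite-dimensional Euclidean spaces, let $P$ be a stochastic kernel on $\mathsf Z$ that is Feller ($z\mapsto\int u\,dP(z,\cdot)$ is continuous for every bounded continuous $u$), let $\varphi$ be a Borel probability measure on a second-countable topological space $\mathsf E$, and let $h:\mathsf Z\times\mathsf E\to\mathsf N$ and $f:\mathbb R_+\times\mathsf N\to\mathbb R_+$ be continuous with $f$ increasing in its first argument (increasing and decreasing are meant weakly). Let $\beta\in(0,1)$. Consider the dynamic program with states $x=(w,z)\in\mathsf X=\mathbb R_+\times\mathsf Z$, actions $s\in\Gamma(w,z)=[0,w]$, state-action pairs $\mathsf D=\{(w,z,s):0\le s\le w\}$, reward $r(w,s)\in\mathbb R\cup\{-\infty\}$ and transitions $w'=f(s,\eta')$, $\eta'=h(z',\varepsilon')$, where $z'\sim P(z,\cdot)$ and $\varepsilon'\sim\varphi$ are independent; $\mathbb E_{z,s}$ denotes the corresponding expectation over $(w',z')$, and $\mathbb E_z$ the expectation over $(z',\varepsilon')$ given $z$. The reward $r$, defined for $0\le s\le w$, is increasing in $w$ and decreasing in $s$; as a map into the extended reals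 it is continuous on $\{s<w\}$ (the interior of $\{s\le w\}$ in $\mathbb R_+^2$); if $r$ is bounded below, it is continuous on all of $\{s\le w\}$; and if $r$ is not bounded below, then for every $w\ge 0$ either $\lim_{s\to w,\,s\le w}r(w,s)=-\infty$ (that is, $r(0,0)=-\infty$ if $w=0$) or $r$ is continuous at $(w,w)$. **Notation.** Let $\kappa:\mathsf X\to[1,\infty)$ be measurable. For $g:\mathsf D\to\mathbb R$ let $\|g\|_\kappa=\sup_{(w,z,s)\in\mathsf D}|g(w,z,s)|/\kappa(w,z)$. Let $\mathcal G$ be the set of Borel measurable $g:\mathsf D\to\mathbb R$ that are bounded below with $\|g\|_\kappa<\infty$, and let $\mathbb G$ be the set of $g\in\mathcal G$ that depend on $(z,s)$ only and are continuous and increasing in $s$. Put $$ m_g(w,z)=\sup_{0\le s\le w}\{r(w,s)+g(w,z,s)\},\qquad Sg(w,z,s)=\beta\,\mathbb E_{z,s}\,m_g(w',z'). $$ A policy is a measurable $\sigma:\mathsf X\to\mathbb R_+$ with $0\le\sigma(w,z)\le w$; it is $g$-greedy if $r(w,\sigma(w,z))+g(w,z,\sigma(w,z))=m_g(w,z)$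 for all $(w,z)$. Its value is $v_\sigma(x)=\sum_{t\ge0}\beta^t\,\mathbb E_x r(w_t,\sigma(w_t,z_t))$, where $(w_t,z_t)$ is the Markov process started at $x$ under $\sigma$; $v^*=\sup_\sigma v_\sigma$, and $\sigma$ is optimal if $v_\sigma=v^*$ everywhere. **Hypotheses.** There are $d\ge0$ and $\alpha\in(0,1/\beta)$ with $\sup_{0\le s\le w}r(w,s)\le d\,\kappa(w,z)$ for all $(w,z)\in\mathsf X$ and $\mathbb E_{z,s}\kappa(w',z')\le\alpha\,\kappa(w,z)$ for all $(w,z,s)\in\mathsf D$. The functions $\kappa$ and $\kappa_e(z,s)=\mathbb E_{z,s}\kappa(w',z')$ are continuous, and $\underline\ell(z)=\mathbb E_z r(f(0,\eta'),0)$ is continuous and bounded below. **Conclusions.** The partial sums of the series defining $v_\sigma(x)$ converge in $[-\infty,\infty)$ for every policy $\sigma$ and $x \in \mathsf X$. Moreover: 0. $\mathbb G$ is closed in $(\mathcal G,\|\cdot\|_\kappa)$, every $g\in\mathbb G$ has a $g$-greedy policy, $S\mathbb G\subset\mathbb G$, and $S$ is a contraction on $(\mathbb G,\|\cdot\|_\kappa)$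 of modulus $\alpha\beta<1$. 1. For every $g\in\mathcal G$, $Sg$ is well defined, real-valued, universally measurable, bounded below, and $\|Sg\|_\kappa<\infty$; and $Sg\in\mathcal G$ whenever $m_g$ is Borel measurable. For all $g_1,g_2\in\mathcal G$, $\|Sg_1-Sg_2\|_\kappa\le\alpha\beta\|g_1-g_2\|_\kappa$. 2. $S$ has a fixed point $g^*\in\mathbb G$, and it is the only fixed point of $S$ in $\mathcal G$. 3. For every $g\in\mathcal G$, $\|S^ng-g^*\|_\kappa=O((\alpha\beta)^n)$. 4. (a) $g^*(w,z,s)=\beta\,\mathbb E_{z,s}v^*(w',z')$ on $\mathsf D$, and $v^*(w,z)=\max_{0\le s\le w}\{r(w,s)+g^*(w,z,s)\}$ on $\mathsf X$, the maximum being attained. (b) An optimal policy exists. (c) A policy is optimal if and only if it is $g^*$-greedy. -/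

import Mathlib

open MeasureTheory ProbabilityTheory Filter
open scoped NNReal ENNReal Topology

noncomputable section

/-- Expectation of an extended-real-valued function: the integral of the positive part minus the
integral of the negative part. (If both are infinite the value is `⊥`; this case never occurs below,
because all integrands have an integrable upper bound.) -/
def expect {Ω : Type*} [MeasurableSpace Ω] (μ : Measure Ω) (h : Ω → EReal) : EReal :=
  ((∫⁻ ω, (h ω).toENNReal ∂μ : ℝ≥0∞) : EReal) - ((∫⁻ ω, (-(h ω)).toENNReal ∂μ : ℝ≥0∞) : EReal)

/-- State-action pairs of a feasible correspondence `Γ`. -/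
abbrev StateAction {X A : Type*} (Γ : X → Set A) : Type _ := {p : X × A // p.2 ∈ Γ p.1}

/-- The data of a dynamic program with state space `X` and action space `A`. -/
structure DynProg (X A : Type*) [MeasurableSpace X] [MeasurableSpace A] where
  /-- feasible correspondence -/
  Γ : X → Set A
  /-- reward function -/
  r : StateAction Γ → EReal
  /-- discount factor -/
  β : ℝ
  /-- stochastic kernel governing the states -/
  Q : Kernel (StateAction Γ) X

namespace DynProg

variable {X A : Type*} [MeasurableSpace X] [MeasurableSpace A]

/-- The set of state-action pairs of the program. -/
abbrev D (p : DynProg X A) : Type _ := StateAction p.Γ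

/-- Feasible policies: measurable selections of the feasible correspondence. -/
structure Policy (p : DynProg X A) where
  /-- the policy as a map from states to actions -/
  toFun : X → A
  measurable : Measurable toFun
  feasible : ∀ x, toFun x ∈ p.Γ x

/-- The state-action pair that the policy `σ` selects at the state `x`. -/
def Policy.pair {p : DynProg X A} (σ : p.Policy) (x : X) : p.D :=
  ⟨(x, σ.toFun x), σ.feasible x⟩

/-- The law of the state `x_t` when the initial state is `x` and the policy `σ` is followed. -/
def stateLaw (p : DynProg X A) (σ : p.Policy) (x : X) : ℕ → Measure X
  | 0 => Measure.dirac x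
  | t + 1 => (p.stateLaw σ x t).bind (fun y => p.Q (σ.pair y))

/-- The discounted expected rewards of `σ` over the periods `t < T`. -/
def partialValue (p : DynProg X A) (σ : p.Policy) (x : X) (T : ℕ) : EReal :=
  ∑ t ∈ Finset.range T,
    ((p.β ^ t : ℝ) : EReal) * expect (p.stateLaw σ x t) (fun y => p.r (σ.pair y))

/-- The value of the policy `σ`: the sum of the series of discounted expected rewards. It is written
as a lower limit of the partial sums, so that it is always meaningful. -/
def policyValue (p : DynProg X A) (σ : p.Policy) (x : X) : EReal :=
  liminf (p.partialValue σ x) atTop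

/-- The value function. -/
def value (p : DynProg X A) (x : X) : EReal := ⨆ σ : p.Policy, p.policyValue σ x

/-- A policy is optimal if its value is the value function, at every state. -/
def IsOptimal (p : DynProg X A) (σ : p.Policy) : Prop := ∀ x, p.policyValue σ x = p.value x

/-- The largest one-period reward at a state. -/
def rbar (p : DynProg X A) (x : X) : EReal := ⨆ a : p.Γ x, p.r ⟨(x, a.1), a.2⟩

/-- `x ↦ sup_{a ∈ Γ x} (r (x, a) + g (x, a))`. -/
def maxValue (p : DynProg X A) (g : p.D → ℝ) (x : X) : EReal :=
  ⨆ a : p.Γ x, (p.r ⟨(x, a.1), a.2⟩ + (g ⟨(x, a.1), a.2⟩ : EReal))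

/-- The transformed Bellman operator, with values in the extended reals. -/
def SE (p : DynProg X A) (g : p.D → ℝ) (q : p.D) : EReal :=
  (p.β : EReal) * expect (p.Q q) (p.maxValue g)

/-- The transformed Bellman operator as an operator on real-valued functions. -/
def S (p : DynProg X A) (g : p.D → ℝ) (q : p.D) : ℝ := (p.SE g q).toReal

/-- `g`-greedy policies. -/
def IsGreedy (p : DynProg X A) (g : p.D → ℝ) (σ : p.Policy) : Prop :=
  ∀ x, p.r (σ.pair x) + (g (σ.pair x) : EReal) = p.maxValue g x

/-- The weighted supremum norm with weight `κ`, as an extended nonnegative real. -/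
def wnorm (p : DynProg X A) (κ : X → ℝ) (g : p.D → ℝ) : ℝ≥0∞ :=
  ⨆ q : p.D, ENNReal.ofReal (|g q| / κ q.1.1)

/-- The measurable functions on state-action pairs that are bounded below and have a finite weighted
supremum norm. -/
def weightedSpace (p : DynProg X A) (κ : X → ℝ) : Set (p.D → ℝ) :=
  {g | Measurable g ∧ (∃ c : ℝ, ∀ q, c ≤ g q) ∧ p.wnorm κ g < ∞}

/-- The growth condition: `κ` is a measurable weight with values in `[1, ∞)`, the rewards are
bounded above by `d * κ`, and `κ` grows in expectation at most by the factor `α < 1 / β`. -/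
structure GrowthCondition (p : DynProg X A) (κ : X → ℝ) (d α : ℝ) : Prop where
  measurable : Measurable κ
  one_le : ∀ x, 1 ≤ κ x
  d_nonneg : 0 ≤ d
  α_pos : 0 < α
  α_lt : α < 1 / p.β
  rbar_le : ∀ x, p.rbar x ≤ ((d * κ x : ℝ) : EReal)
  expect_le : ∀ q : p.D, expect (p.Q q) (fun x => (κ x : EReal)) ≤ ((α * κ q.1.1 : ℝ) : EReal)

end DynProg

/-- The data of a savings-type problem: `0 ≤ s_t ≤ w_t`, `w_{t+1} = f (s_t, η_{t+1})`,
`η_t = h (z_t, ε_t)`, with `z_t` Markov with kernel `P` and `ε_t` IID with law `φ`, independent of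
the process `z_t`. The values of `r w s` matter only for `s ≤ w`. -/
structure SavingsProblem (Z N E : Type*) [MeasurableSpace Z] [MeasurableSpace E] where
  /-- law of motion of wealth -/
  f : ℝ≥0 × N → ℝ≥0
  /-- the shock to wealth as a function of the exogenous state and the innovation -/
  h : Z × E → N
  /-- reward -/
  r : ℝ≥0 → ℝ≥0 → EReal
  /-- discount factor -/
  β : ℝ
  /-- stochastic kernel of the exogenous state -/
  P : Kernel Z Z
  /-- law of the innovation -/
  φ : Measure E

namespace SavingsProblem

/-- The pairs `(w, s)` with `0 ≤ s ≤ w`. -/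
def region : Set (ℝ≥0 × ℝ≥0) := {q | q.2 ≤ q.1}

section Basic

variable {Z N E : Type*} [MeasurableSpace Z] [MeasurableSpace E]

/-- The feasible correspondence `(w, z) ↦ [0, w]`. -/
def feasible (x : ℝ≥0 × Z) : Set ℝ≥0 := Set.Iic x.1

/-- The kernel that sends `(z, s)` to the law of `(w', z')`, where `w' = f (s, h (z', ε'))`. -/
def transition (M : SavingsProblem Z N E) : Kernel (Z × ℝ≥0) (ℝ≥0 × Z) :=
  (Kernel.deterministic (fun y : Z × ℝ≥0 => y.2) measurable_snd ×ₖ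
      (M.P ×ₖ Kernel.const Z M.φ).comap (fun y : Z × ℝ≥0 => y.1) measurable_fst).map
    (fun u : ℝ≥0 × (Z × E) => (M.f (u.1, M.h u.2), u.2.1))

/-- The savings-type problem as a dynamic program with states `(w, z)` and actions `s`. -/
def dp (M : SavingsProblem Z N E) : DynProg (ℝ≥0 × Z) ℝ≥0 where
  Γ := feasible
  r := fun q => M.r q.1.1.1 q.1.2
  β := M.β
  Q := M.transition.comap (fun q : StateAction (feasible (Z := Z)) => (q.1.1.2, q.1.2)) (by fun_prop)

/-- `z ↦ E_z r (f (0, η'), 0)`. -/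
def lowerEll (M : SavingsProblem Z N E) (z : Z) : EReal :=
  expect ((M.P z).prod M.φ) (fun u => M.r (M.f (0, M.h u)) 0)

/-- `(z, s) ↦ E_{z,s} κ (w', z')`. -/
def kappaE (M : SavingsProblem Z N E) (κ : ℝ≥0 × Z → ℝ) (y : Z × ℝ≥0) : EReal :=
  expect (M.transition y) (fun x => (κ x : EReal))

/-- The rewards are bounded below. -/
def RewardBddBelow (M : SavingsProblem Z N E) : Prop :=
  ∃ c : ℝ, ∀ w s : ℝ≥0, s ≤ w → (c : EReal) ≤ M.r w s

/-- The functions in the weighted space that depend on `(z, s)` only, and are continuous and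
increasing in `s`. -/
def monoSpace [TopologicalSpace Z] (M : SavingsProblem Z N E) (κ : ℝ≥0 × Z → ℝ) :
    Set (M.dp.D → ℝ) :=
  {g | g ∈ M.dp.weightedSpace κ ∧ ∃ g₀ : Z × ℝ≥0 → ℝ, Continuous g₀ ∧
    (∀ z, Monotone (fun s => g₀ (z, s))) ∧ ∀ q : M.dp.D, g q = g₀ (q.1.1.2, q.1.2)}

end Basic

/-- The standing assumptions on a savings-type problem. Continuity of `r` is meant in the extended
reals, and the interior is the one relative to `ℝ₊ × ℝ₊`. -/
structure Admissible {Z N E : Type*} [TopologicalSpace Z] [MeasurableSpace Z] [TopologicalSpace N]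
    [TopologicalSpace E] [MeasurableSpace E] (M : SavingsProblem Z N E) : Prop where
  β_pos : 0 < M.β
  β_lt_one : M.β < 1
  continuous_f : Continuous M.f
  monotone_f : ∀ η, Monotone (fun s => M.f (s, η))
  continuous_h : Continuous M.h
  markov : IsMarkovKernel M.P
  feller : ∀ u : BoundedContinuousFunction Z ℝ, Continuous (fun z => ∫ z', u z' ∂(M.P z))
  prob : IsProbabilityMeasure M.φ
  r_ne_top : ∀ w s, s ≤ w → M.r w s ≠ ⊤
  r_mono : ∀ s w₁ w₂, s ≤ w₁ → w₁ ≤ w₂ → M.r w₁ s ≤ M.r w₂ s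
  r_anti : ∀ w s₁ s₂, s₁ ≤ s₂ → s₂ ≤ w → M.r w s₂ ≤ M.r w s₁
  r_cont_interior : ContinuousOn (fun q : ℝ≥0 × ℝ≥0 => M.r q.1 q.2) (interior region)
  r_cont_of_bddBelow : M.RewardBddBelow →
    ContinuousOn (fun q : ℝ≥0 × ℝ≥0 => M.r q.1 q.2) region
  r_diag : ¬ M.RewardBddBelow → ∀ w : ℝ≥0,
    Tendsto (fun s => M.r w s) (𝓝[≤] w) (𝓝 ⊥) ∨
      ContinuousWithinAt (fun q : ℝ≥0 × ℝ≥0 => M.r q.1 q.2) region (w, w)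

end SavingsProblem

end

/-! Rewards may equal `⊥`, so the value function need not be finite or bounded below, and the usual
Bellman operator has no good normed space to act on. The cure is to maximize first and take
expectations afterwards: the unknown is the discounted expected continuation value. It is finite
because the best reward at wealth `w` is `r w 0`, next wealth is at least `f (0, η')`, and the
expectation of `r (f (0, η')) 0` is bounded below; the growth condition bounds it above.

For `S` so defined, monotonicity of the supremum gives `maxValue g₁ ≤ maxValue g₂ + K κ` whenever
`g₁ ≤ g₂ + K κ`, and `E κ ≤ α κ` turns this into the contraction estimate (`abs_S_sub_le`). Picard
iterates from `0` stay in any closed invariant class, so the fixed point lies in `monoSpace` once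
that class is shown closed and invariant. For a general Borel `g` the inner supremum is only
universally measurable, its superlevel sets being projections of Borel sets.

Invariance is the analytic core (`continuous_expect_cutValue`). Monotonicity forces `r` to be
continuous in the extended reals except possibly at zero wealth, and finiteness of `lowerEll` makes
the exceptional next states negligible. The unbounded integrand lies between a shifted `lowerEll`
integrand and a multiple of `κ`; both have continuous expectations, so a Fatou argument for Feller
kernels gives continuity in `z`. Dominated convergence gives continuity in `s`, and monotonicity in
`s` makes it joint.

For optimality, put `v = maxValue gs` at the fixed point `gs`. The `T`-period value of a policy plus
`β ^ T E v(x_T)` is decreasing in `T`, constant if the policy is greedy, and tends to the value of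
the policy. Comparison with `T = 1` and `T = 0` identifies the value function and shows that optimal
means greedy. -/

section Expect

/-! ### Calculus of extended-real expectations. -/

variable {Ω : Type*} [MeasurableSpace Ω] {μ : Measure Ω}

theorem expect_mono_ae {u v : Ω → EReal} (h : u ≤ᵐ[μ] v) : expect μ u ≤ expect μ v := by
  refine EReal.sub_le_sub ?_ ?_
  · exact EReal.coe_ennreal_le_coe_ennreal_iff.2
      (lintegral_mono_ae (h.mono fun x hx => EReal.toENNReal_le_toENNReal hx))
  · exact EReal.coe_ennreal_le_coe_ennreal_iff.2
      (lintegral_mono_ae (h.mono fun x hx =>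
        EReal.toENNReal_le_toENNReal (EReal.neg_le_neg_iff.2 hx)))

theorem expect_mono {u v : Ω → EReal} (h : ∀ x, u x ≤ v x) : expect μ u ≤ expect μ v :=
  expect_mono_ae (Eventually.of_forall h)

theorem expect_congr_ae {u v : Ω → EReal} (h : u =ᵐ[μ] v) : expect μ u = expect μ v :=
  le_antisymm (expect_mono_ae h.le) (expect_mono_ae h.symm.le)

/-- For `x = a - b` this is `x⁺ + b = a + x⁻`, written without subtraction so that it can be
integrated even when `b` is infinite. -/
theorem EReal.toENNReal_coe_sub_add (a b : ℝ≥0∞) (ha : a ≠ ∞) :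
    ((a : EReal) - b).toENNReal + b = a + (-((a : EReal) - b)).toENNReal := by
  lift a to ℝ≥0 using ha
  induction b with
  | top => simp [sub_eq_add_neg]
  | coe b =>
    have h1 : (((a : ℝ≥0∞) : EReal) - ((b : ℝ≥0∞) : EReal)) = (((a : ℝ) - (b : ℝ) : ℝ) : EReal) := by
      push_cast; rfl
    rw [h1, ← EReal.coe_neg, EReal.real_coe_toENNReal, EReal.real_coe_toENNReal]
    rw [← ENNReal.ofReal_coe_nnreal, ← ENNReal.ofReal_coe_nnreal]
    rcases le_total (a : ℝ) b with h | h
    · rw [ENNReal.ofReal_of_nonpos (p := (a : ℝ) - b) (by linarith),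
        ← ENNReal.ofReal_add (by simp) (by linarith)]
      simp
    · rw [ENNReal.ofReal_of_nonpos (p := -((a : ℝ) - b)) (by linarith),
        ← ENNReal.ofReal_add (by linarith) (by simp)]
      simp

theorem EReal.coe_sub_coe_eq_of_add_eq {a b c d : ℝ≥0∞} (ha : a ≠ ∞) (hc : c ≠ ∞)
    (h : a + d = c + b) : (a : EReal) - b = (c : EReal) - d := by
  lift a to ℝ≥0 using ha
  lift c to ℝ≥0 using hc
  induction b with
  | top =>
    have : d = ∞ := by simpa using h
    subst this; simp [sub_eq_add_neg]
  | coe b =>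
    induction d with
    | top => exact absurd h (by simp [← ENNReal.coe_add])
    | coe d =>
      have h' : (a : ℝ) + d = c + b := by exact_mod_cast h
      change (((a : ℝ) - (b : ℝ) : ℝ) : EReal) = (((c : ℝ) - (d : ℝ) : ℝ) : EReal)
      congr 1; linarith

/-- Here `a` and `b` need not be the positive and negative parts: any decomposition with `∫ a`
finite will do. The subtraction-free identity is integrated and then rearranged. Additivity and
iterated expectations both reduce to this. -/
theorem expect_coe_sub {a b : Ω → ℝ≥0∞} (ha : AEMeasurable a μ) (hb : AEMeasurable b μ)
    (hfin : ∫⁻ x, a x ∂μ ≠ ∞) :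
    expect μ (fun x => (a x : EReal) - b x) =
      ((∫⁻ x, a x ∂μ : ℝ≥0∞) : EReal) - ((∫⁻ x, b x ∂μ : ℝ≥0∞) : EReal) := by
  have hle : ∀ x, ((a x : EReal) - b x).toENNReal ≤ a x := fun x => by
    refine (EReal.toENNReal_le_toENNReal (y := (a x : EReal)) ?_).trans_eq EReal.toENNReal_coe
    simpa using EReal.sub_le_sub (le_refl (a x : EReal)) (EReal.coe_ennreal_nonneg (b x))
  refine EReal.coe_sub_coe_eq_of_add_eq ?_ hfin ?_
  · exact ((lintegral_mono hle).trans_lt hfin.lt_top).ne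
  · rw [← lintegral_add_right' _ hb, ← lintegral_add_left' ha]
    refine lintegral_congr_ae ?_
    filter_upwards [ae_lt_top' ha hfin] with x hx
    exact EReal.toENNReal_coe_sub_add _ _ hx.ne

theorem EReal.toENNReal_sub_toENNReal_neg (x : EReal) :
    (x.toENNReal : EReal) - ((-x).toENNReal : EReal) = x := by
  induction x with
  | bot => simp
  | top => simp
  | coe x =>
    rw [← EReal.coe_neg, EReal.real_coe_toENNReal, EReal.real_coe_toENNReal,
      EReal.coe_ennreal_ofReal, EReal.coe_ennreal_ofReal]
    norm_cast
    rcases le_total 0 x with h | h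
    · rw [max_eq_left h, max_eq_right (by linarith)]; simp
    · rw [max_eq_right h, max_eq_left (by linarith)]; simp

theorem expect_add {u v : Ω → EReal} (hu : AEMeasurable u μ) (hv : AEMeasurable v μ)
    (hu' : ∫⁻ x, (u x).toENNReal ∂μ ≠ ∞) (hv' : ∫⁻ x, (v x).toENNReal ∂μ ≠ ∞) :
    expect μ (fun x => u x + v x) = expect μ u + expect μ v := by
  have e : expect μ (fun x => u x + v x) =
      expect μ (fun x => (((u x).toENNReal + (v x).toENNReal : ℝ≥0∞) : EReal) -
        (((-u x).toENNReal + (-v x).toENNReal : ℝ≥0∞) : EReal)) := by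
    refine expect_congr_ae (Eventually.of_forall fun x => ?_)
    simp only []
    rw [EReal.coe_ennreal_add, EReal.coe_ennreal_add, EReal.add_sub_add_comm (by simp) (by simp),
      EReal.toENNReal_sub_toENNReal_neg, EReal.toENNReal_sub_toENNReal_neg]
  have hun : AEMeasurable (fun x => (-u x).toENNReal) μ := hu.neg.ereal_toENNReal
  have hvn : AEMeasurable (fun x => (-v x).toENNReal) μ := hv.neg.ereal_toENNReal
  rw [e, expect_coe_sub (a := fun x => (u x).toENNReal + (v x).toENNReal)
      (b := fun x => (-u x).toENNReal + (-v x).toENNReal)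
      (hu.ereal_toENNReal.add hv.ereal_toENNReal) (hun.add hvn),
    lintegral_add_left' hu.ereal_toENNReal, lintegral_add_left' hun, EReal.coe_ennreal_add,
    EReal.coe_ennreal_add, EReal.add_sub_add_comm (by simp) (by simp)]
  · rfl
  · rw [lintegral_add_left' hu.ereal_toENNReal]
    exact ENNReal.add_ne_top.2 ⟨hu', hv'⟩

theorem expect_of_nonneg {u : Ω → EReal} (hu : ∀ x, 0 ≤ u x) :
    expect μ u = ((∫⁻ x, (u x).toENNReal ∂μ : ℝ≥0∞) : EReal) := by
  have : ∀ x, (-u x).toENNReal = 0 := fun x =>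
    EReal.toENNReal_of_nonpos (by simpa using hu x)
  simp [expect, this]

theorem expect_coe {f : Ω → ℝ} (hf : Integrable f μ) :
    expect μ (fun x => (f x : EReal)) = ((∫ x, f x ∂μ : ℝ) : EReal) := by
  have h1 : ∫⁻ x, ENNReal.ofReal (f x) ∂μ ≠ ∞ := hf.lintegral_lt_top.ne
  have h2 : ∫⁻ x, ENNReal.ofReal (-f x) ∂μ ≠ ∞ := hf.neg.lintegral_lt_top.ne
  rw [integral_eq_lintegral_pos_part_sub_lintegral_neg_part hf, EReal.coe_sub,
    EReal.coe_ennreal_toReal h1, EReal.coe_ennreal_toReal h2]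
  rfl

theorem expect_const [IsProbabilityMeasure μ] (c : ℝ) :
    expect μ (fun _ => (c : EReal)) = c := by
  rw [expect_coe (integrable_const c)]; simp

theorem integrable_toReal_of_expect_ne {u : Ω → EReal} (hu : AEMeasurable u μ)
    (hb : expect μ u ≠ ⊥) (ht : expect μ u ≠ ⊤) :
    (∀ᵐ x ∂μ, ((u x).toReal : EReal) = u x) ∧ Integrable (fun x => (u x).toReal) μ := by
  -- The negative part comes first: `∞ - ∞` is `⊥`, so only once its integral is finite does an
  -- infinite positive part give `⊤`.
  have hn : ∫⁻ x, (-u x).toENNReal ∂μ ≠ ∞ := fun h => hb (by simp [expect, h])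
  have hp : ∫⁻ x, (u x).toENNReal ∂μ ≠ ∞ := fun h => ht (by
    rw [expect, h, EReal.coe_ennreal_top]; exact EReal.top_sub (by simpa using hn))
  have hae : ∀ᵐ x ∂μ, ((u x).toReal : EReal) = u x := by
    filter_upwards [ae_lt_top' hu.ereal_toENNReal hp,
      ae_lt_top' (f := fun x => (-u x).toENNReal) hu.neg.ereal_toENNReal hn] with x h1 h2
    refine EReal.coe_toReal (fun h => ?_) (fun h => ?_)
    · simp [h] at h1
    · simp [h] at h2
  refine ⟨hae, hu.ereal_toReal.aestronglyMeasurable, ?_⟩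
  rw [hasFiniteIntegral_iff_norm]
  calc ∫⁻ x, ENNReal.ofReal ‖(u x).toReal‖ ∂μ
      = ∫⁻ x, ((u x).toENNReal + (-u x).toENNReal) ∂μ := by
        refine lintegral_congr_ae (hae.mono fun x hx => ?_)
        simp only []
        conv_rhs => rw [← hx, ← EReal.coe_neg, EReal.real_coe_toENNReal, EReal.real_coe_toENNReal]
        rw [Real.norm_eq_abs]
        rcases le_total 0 (u x).toReal with h | h
        · rw [abs_of_nonneg h, ENNReal.ofReal_of_nonpos (p := -(u x).toReal) (by linarith), add_zero]
        · rw [abs_of_nonpos h, ENNReal.ofReal_of_nonpos h, zero_add]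
    _ = _ := lintegral_add_left' hu.ereal_toENNReal _
    _ < ∞ := ENNReal.add_lt_top.2 ⟨hp.lt_top, hn.lt_top⟩

theorem expect_eq_integral_toReal {u : Ω → EReal} (hu : AEMeasurable u μ)
    (hb : expect μ u ≠ ⊥) (ht : expect μ u ≠ ⊤) :
    expect μ u = ((∫ x, (u x).toReal ∂μ : ℝ) : EReal) := by
  obtain ⟨h1, h2⟩ := integrable_toReal_of_expect_ne hu hb ht
  rw [← expect_coe h2]
  exact expect_congr_ae (h1.mono fun x hx => hx.symm)

theorem expect_const_mul {c : ℝ} (hc : 0 ≤ c) (u : Ω → EReal) (hu : AEMeasurable u μ) :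
    expect μ (fun x => (c : EReal) * u x) = (c : EReal) * expect μ u := by
  have hc' : (0 : EReal) ≤ c := by exact_mod_cast hc
  have h1 : ∀ x, ((c : EReal) * u x).toENNReal = ENNReal.ofReal c * (u x).toENNReal := fun x => by
    rw [EReal.toENNReal_mul hc', EReal.real_coe_toENNReal]
  have h2 : ∀ x, (-((c : EReal) * u x)).toENNReal = ENNReal.ofReal c * (-u x).toENNReal :=
    fun x => by rw [← mul_neg, EReal.toENNReal_mul hc', EReal.real_coe_toENNReal]
  simp only [expect, h1, h2]
  rw [lintegral_const_mul'' _ hu.ereal_toENNReal,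
    lintegral_const_mul'' _ (f := fun x => (-u x).toENNReal) hu.neg.ereal_toENNReal,
    EReal.coe_ennreal_mul, EReal.coe_ennreal_mul, EReal.coe_ennreal_ofReal, max_eq_left hc,
    sub_eq_add_neg, sub_eq_add_neg, ← mul_neg,
    EReal.left_distrib_of_nonneg_of_ne_top hc' (EReal.coe_ne_top c)]

theorem expect_dirac {u : Ω → EReal} (hu : Measurable u) (x : Ω) :
    expect (Measure.dirac x) u = u x := by
  rw [expect, lintegral_dirac' _ hu.ereal_toENNReal,
    lintegral_dirac' (f := fun x => (-u x).toENNReal) _ hu.neg.ereal_toENNReal,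
    EReal.toENNReal_sub_toENNReal_neg]

theorem expect_map {Ω' : Type*} [MeasurableSpace Ω'] {f : Ω → Ω'} (hf : Measurable f)
    {u : Ω' → EReal} (hu : Measurable u) :
    expect (μ.map f) u = expect μ (fun x => u (f x)) := by
  rw [expect, expect, lintegral_map hu.ereal_toENNReal hf,
    lintegral_map (f := fun x => (-u x).toENNReal) hu.neg.ereal_toENNReal hf]

theorem measurable_expect {Ω' : Type*} [MeasurableSpace Ω'] {K : Ω' → Measure Ω}
    (hK : Measurable K) {u : Ω → EReal} (hu : Measurable u) :
    Measurable fun y => expect (K y) u := by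
  have h1 : Measurable fun y => ∫⁻ x, (u x).toENNReal ∂(K y) :=
    (Measure.measurable_lintegral hu.ereal_toENNReal).comp hK
  have h2 : Measurable fun y => ∫⁻ x, (-u x).toENNReal ∂(K y) :=
    (Measure.measurable_lintegral (f := fun x => (-u x).toENNReal) hu.neg.ereal_toENNReal).comp hK
  simp only [expect, sub_eq_add_neg]
  exact h1.coe_ereal_ennreal.add h2.coe_ereal_ennreal.neg

/-- The inner expectation is `a - b` with `a`, `b` the kernel integrals of the two parts; finiteness
of the total positive part is the condition of `expect_coe_sub`. -/
theorem expect_bind {Ω' : Type*} [MeasurableSpace Ω'] {K : Ω → Measure Ω'}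
    (hK : Measurable K) {u : Ω' → EReal} (hu : Measurable u)
    (hfin : ∫⁻ y, (u y).toENNReal ∂(μ.bind K) ≠ ∞) :
    expect (μ.bind K) u = expect μ (fun x => expect (K x) u) := by
  have hn : Measurable fun y => (-u y).toENNReal := hu.neg.ereal_toENNReal
  rw [Measure.lintegral_bind hK.aemeasurable hu.ereal_toENNReal.aemeasurable] at hfin
  rw [expect, Measure.lintegral_bind hK.aemeasurable hu.ereal_toENNReal.aemeasurable,
    Measure.lintegral_bind hK.aemeasurable hn.aemeasurable, ← expect_coe_sub _ _ hfin]
  · rfl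
  · exact ((Measure.measurable_lintegral hu.ereal_toENNReal).comp hK).aemeasurable
  · exact ((Measure.measurable_lintegral hn).comp hK).aemeasurable

end Expect

/-! ### Universal measurability of suprema over fibres. -/

section Analytic

open Set in
/-- Analytic sets are universally measurable. -/
theorem MeasureTheory.AnalyticSet.nullMeasurableSet {Y : Type*} [TopologicalSpace Y] [T2Space Y]
    [MeasurableSpace Y] [OpensMeasurableSpace Y] {A : Set Y} (hA : AnalyticSet A)
    (μ : Measure Y) [IsFiniteMeasure μ] [μ.OuterRegular] : NullMeasurableSet A μ := by
  rw [AnalyticSet] at hA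
  rcases hA with rfl | ⟨f, hf, rfl⟩
  · exact nullMeasurableSet_empty
  -- inner approximation by compact sets
  suffices H : ∀ ε : ℝ≥0∞, ε ≠ 0 → ∃ K ⊆ range f, MeasurableSet K ∧ μ (range f) ≤ μ K + ε by
    choose K hKs hKm hK using fun n : ℕ => H ((n : ℝ≥0∞) + 1)⁻¹ (by simp)
    have hm : MeasurableSet (⋃ n, K n) := MeasurableSet.iUnion hKm
    have hs : (⋃ n, K n) ⊆ range f := iUnion_subset hKs
    have hle : μ (range f) ≤ μ (⋃ n, K n) := by
      have ht : Tendsto (fun n : ℕ => μ (⋃ n, K n) + ((n : ℝ≥0∞) + 1)⁻¹) atTop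
          (𝓝 (μ (⋃ n, K n) + 0)) := by
        refine Tendsto.const_add _ ?_
        have := (tendsto_add_atTop_iff_nat 1).2 ENNReal.tendsto_inv_nat_nhds_zero
        simpa using this
      rw [add_zero] at ht
      exact ge_of_tendsto' ht fun n =>
        (hK n).trans (add_le_add_left (measure_mono (subset_iUnion K n)) _)
    have : (⋃ n, K n) =ᵐ[μ] range f :=
      ae_eq_of_subset_of_measure_ge hs hle hm.nullMeasurableSet (measure_ne_top _ _)
    exact hm.nullMeasurableSet.congr this
  intro ε hε
  obtain ⟨δ, hδ0, hδ⟩ := ENNReal.exists_pos_sum_of_countable' hε ℕ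
  -- bounded pieces of the Baire space
  let C : (ℕ → ℕ) → ℕ → Set (ℕ → ℕ) := fun k n => {x | ∀ i < n, x i ≤ k i}
  -- Capping coordinate `n` at a large `m` loses little mass. Continuity from below holds for
  -- increasing sets without measurability, which is not known for these images.
  have step : ∀ (n : ℕ) (S : Set (ℕ → ℕ)), ∃ m : ℕ,
      μ (f '' S) ≤ μ (f '' (S ∩ {x | x n ≤ m})) + δ n := by
    intro n S
    have hmono : Monotone fun m : ℕ => f '' (S ∩ {x | x n ≤ m}) := fun a b hab =>
      image_mono (inter_subset_inter_right _ fun x (hx : x n ≤ a) => hx.trans hab)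
    have hU : f '' S = ⋃ m : ℕ, f '' (S ∩ {x | x n ≤ m}) := by
      rw [← image_iUnion, ← inter_iUnion]
      congr 1
      refine (inter_eq_left.2 fun x _ => mem_iUnion.2 ⟨x n, by simp⟩).symm
    have ht := tendsto_measure_iUnion_atTop (μ := μ) hmono
    rw [← hU] at ht
    by_cases h0 : μ (f '' S) = 0
    · exact ⟨0, by simp [h0]⟩
    · have hlt : μ (f '' S) - δ n < μ (f '' S) :=
        ENNReal.sub_lt_self (measure_ne_top _ _) h0 (hδ0 n).ne'
      obtain ⟨m, hm⟩ := (ht.eventually (lt_mem_nhds hlt)).exists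
      exact ⟨m, tsub_le_iff_right.1 hm.le⟩
  choose M hM using step
  let T : ℕ → Set (ℕ → ℕ) := fun n => Nat.rec univ (fun n S => S ∩ {x | x n ≤ M n S}) n
  let k : ℕ → ℕ := fun n => M n (T n)
  have hT : ∀ n, T (n + 1) = T n ∩ {x | x n ≤ k n} := fun n => rfl
  have hTC : ∀ n, T n = {x | ∀ i < n, x i ≤ k i} := by
    intro n
    induction n with
    | zero => ext x; simp [T]
    | succ n ih =>
      rw [hT, ih]; ext x
      simp only [mem_inter_iff, mem_ofPred_eq, Nat.lt_succ_iff_lt_or_eq]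
      constructor
      · rintro ⟨h1, h2⟩ i (hi | rfl)
        · exact h1 i hi
        · exact h2
      · exact fun h => ⟨fun i hi => h i (Or.inl hi), h n (Or.inr rfl)⟩
  have hmeas : ∀ n, μ (range f) ≤ μ (f '' T n) + ∑ i ∈ Finset.range n, δ i := by
    intro n
    induction n with
    | zero => simp [T]
    | succ n ih =>
      calc μ (range f) ≤ μ (f '' T n) + ∑ i ∈ Finset.range n, δ i := ih
        _ ≤ (μ (f '' T (n + 1)) + δ n) + ∑ i ∈ Finset.range n, δ i := by
          gcongr; exact hM n (T n)
        _ = _ := by rw [Finset.sum_range_succ]; ring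
  let L : Set (ℕ → ℕ) := univ.pi fun i => Iic (k i)
  have hL : IsCompact L := isCompact_univ_pi fun i => (finite_Iic (k i)).isCompact
  -- `L` is the intersection of the `T n`, but continuity from above is not available for the
  -- images. Compactness of `L` replaces it: neighbourhoods of `f '' L` absorb some `f '' T n`, and
  -- outer regularity then compares measures.
  have hLim : ∀ U : Set Y, IsOpen U → f '' L ⊆ U → ∃ n, f '' T n ⊆ U := by
    intro U hU hLU
    by_contra! hcon
    have h1 : ∀ n, ∃ x ∈ T n, f x ∉ U := fun n => by
      obtain ⟨_, ⟨x, hx, rfl⟩, hxU⟩ := not_subset.1 (hcon n)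
      exact ⟨x, hx, hxU⟩
    choose x hx hxU using h1
    -- truncate to land in the compact set
    let y : ℕ → ℕ → ℕ := fun n i => min (x n i) (k i)
    have hy : ∀ n, y n ∈ L := fun n i _ => by simp [y]
    obtain ⟨a, haL, φ, hφ, hlim⟩ := hL.tendsto_subseq hy
    have hxlim : Tendsto (x ∘ φ) atTop (𝓝 a) := by
      rw [tendsto_pi_nhds] at hlim ⊢
      intro i
      refine (hlim i).congr' ?_
      filter_upwards [eventually_gt_atTop i] with n hn
      have : x (φ n) i ≤ k i := by
        have := hx (φ n); rw [hTC] at this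
        exact this i (hn.trans_le (hφ.id_le n))
      simp [y, this]
    have : f a ∈ Uᶜ := hU.isClosed_compl.mem_of_tendsto ((hf.tendsto a).comp hxlim)
      (Eventually.of_forall fun n => hxU (φ n))
    exact this (hLU (mem_image_of_mem f haL))
  refine ⟨f '' L, image_subset_range _ _, (hL.image hf).isClosed.measurableSet, ?_⟩
  refine ENNReal.le_of_forall_pos_le_add fun η hη _ => ?_
  obtain ⟨U, hLU, hU, hUμ⟩ := (f '' L).exists_isOpen_le_add μ (ε := η) (by simpa using hη.ne')
  obtain ⟨n, hn⟩ := hLim U hU hLU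
  calc μ (range f) ≤ μ (f '' T n) + ∑ i ∈ Finset.range n, δ i := hmeas n
    _ ≤ (μ (f '' L) + η) + ε := by
      refine add_le_add ((measure_mono hn).trans hUμ) ?_
      exact (ENNReal.sum_le_tsum _).trans hδ.le
    _ = μ (f '' L) + ε + η := by ring

/-- The supremum over the fibres of a Borel function is universally measurable. -/
theorem aemeasurable_iSup_fiber {T Y : Type*} [MeasurableSpace T] [StandardBorelSpace T]
    [TopologicalSpace Y] [T2Space Y] [SecondCountableTopology Y] [MeasurableSpace Y] [BorelSpace Y]
    {F : T → EReal} (hF : Measurable F) {π : T → Y} (hπ : Measurable π)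
    (μ : Measure Y) [IsFiniteMeasure μ] [μ.OuterRegular] :
    AEMeasurable (fun y => ⨆ t : {t // π t = y}, F t) μ := by
  refine (NullMeasurable.aemeasurable (μ := μ) ?_)
  refine measurable_of_Ioi (α := EReal) (δ := NullMeasurableSpace Y μ) fun c => ?_
  -- A supremum exceeds `c` strictly only if some term does, so a superlevel set is a projection of
  -- a Borel set, hence analytic.
  have : (fun y => ⨆ t : {t // π t = y}, F t) ⁻¹' Set.Ioi c = π '' (F ⁻¹' Set.Ioi c) := by
    ext y
    simp only [Set.mem_preimage, Set.mem_Ioi, lt_iSup_iff, Set.mem_image]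
    constructor
    · rintro ⟨⟨t, ht⟩, h⟩; exact ⟨t, h, ht⟩
    · rintro ⟨t, h, ht⟩; exact ⟨⟨t, ht⟩, h⟩
  refine (congrArg (fun s => NullMeasurableSet s μ) this).mpr ?_
  exact ((hF measurableSet_Ioi).analyticSet_image hπ).nullMeasurableSet μ

end Analytic

/-! ### The contraction property of the transformed Bellman operator. -/

namespace DynProg

variable {X A : Type*} [MeasurableSpace X] [MeasurableSpace A]

/-- The conditions on a dynamic program under which the transformed Bellman operator is studied:
the growth condition, measurability of the primitives and of the inner suprema, and a lower bound
for the expected largest one-period reward. -/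
structure Regular (p : DynProg X A) (κ : X → ℝ) (d α ℓ : ℝ) : Prop where
  β_pos : 0 < p.β
  β_lt_one : p.β < 1
  markov : IsMarkovKernel p.Q
  growth : p.GrowthCondition κ d α
  measurable_r : Measurable p.r
  measurable_rbar : Measurable p.rbar
  le_expect_rbar : ∀ q, (ℓ : EReal) ≤ expect (p.Q q) p.rbar
  aemeasurable_maxValue : ∀ g : p.D → ℝ, Measurable g → ∀ μ : Measure X, IsFiniteMeasure μ →
    AEMeasurable (p.maxValue g) μ

section Norm

variable {p : DynProg X A} {κ : X → ℝ}

theorem wnorm_le_ofReal (hκ : ∀ x, 1 ≤ κ x) {g : p.D → ℝ} {K : ℝ}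
    (h : ∀ q, |g q| ≤ K * κ q.1.1) : p.wnorm κ g ≤ ENNReal.ofReal K := by
  refine iSup_le fun q => ENNReal.ofReal_le_ofReal ?_
  rw [div_le_iff₀ (by linarith [hκ q.1.1])]
  exact h q

theorem abs_le_of_wnorm_le (hκ : ∀ x, 1 ≤ κ x) {g : p.D → ℝ} {K : ℝ} (hK : 0 ≤ K)
    (h : p.wnorm κ g ≤ ENNReal.ofReal K) (q : p.D) : |g q| ≤ K * κ q.1.1 := by
  have h1 : ENNReal.ofReal (|g q| / κ q.1.1) ≤ ENNReal.ofReal K :=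
    (le_iSup (fun q : p.D => ENNReal.ofReal (|g q| / κ q.1.1)) q).trans h
  rwa [ENNReal.ofReal_le_ofReal_iff hK, div_le_iff₀ (by linarith [hκ q.1.1])] at h1

theorem abs_le_toReal_wnorm (hκ : ∀ x, 1 ≤ κ x) {g : p.D → ℝ} (h : p.wnorm κ g < ∞) (q : p.D) :
    |g q| ≤ (p.wnorm κ g).toReal * κ q.1.1 :=
  abs_le_of_wnorm_le hκ ENNReal.toReal_nonneg (ENNReal.ofReal_toReal h.ne).ge q

end Norm

section MaxValue

variable {p : DynProg X A} {κ : X → ℝ}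

/-- The weight depends on the state only, so it leaves the supremum. The estimate is one-sided and
additive because both suprema may be `⊥`, where a difference is meaningless. -/
theorem maxValue_le_add {g₁ g₂ : p.D → ℝ} {K : ℝ} (h : ∀ q, g₁ q ≤ g₂ q + K * κ q.1.1) (x : X) :
    p.maxValue g₁ x ≤ p.maxValue g₂ x + ((K * κ x : ℝ) : EReal) := by
  refine iSup_le fun a => ?_
  calc p.r ⟨(x, a.1), a.2⟩ + (g₁ ⟨(x, a.1), a.2⟩ : EReal)
      ≤ p.r ⟨(x, a.1), a.2⟩ + ((g₂ ⟨(x, a.1), a.2⟩ + K * κ x : ℝ) : EReal) := by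
        gcongr; exact_mod_cast h _
    _ = (p.r ⟨(x, a.1), a.2⟩ + (g₂ ⟨(x, a.1), a.2⟩ : EReal)) + ((K * κ x : ℝ) : EReal) := by
        rw [EReal.coe_add, add_assoc]
    _ ≤ _ := by
        gcongr
        exact le_iSup (fun a : p.Γ x =>
          p.r ⟨(x, a.1), a.2⟩ + (g₂ ⟨(x, a.1), a.2⟩ : EReal)) a

theorem maxValue_zero (p : DynProg X A) : p.maxValue (fun _ => 0) = p.rbar := by
  funext x; simp [maxValue, rbar]

theorem rbar_add_le_maxValue {g : p.D → ℝ} {c : ℝ} (h : ∀ q, c ≤ g q) (x : X) :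
    p.rbar x + (c : EReal) ≤ p.maxValue g x := by
  have := maxValue_le_add (p := p) (κ := fun _ => 1) (g₁ := fun _ => 0) (g₂ := g) (K := -c)
    (fun q => by have := h q; linarith) x
  rw [maxValue_zero] at this
  calc p.rbar x + (c : EReal) ≤ (p.maxValue g x + ((-c * 1 : ℝ) : EReal)) + (c : EReal) := by gcongr
    _ = p.maxValue g x := by
      rw [add_assoc, ← EReal.coe_add]; simp

theorem maxValue_le {g : p.D → ℝ} {d α K : ℝ} (hG : p.GrowthCondition κ d α)
    (h : ∀ q, g q ≤ K * κ q.1.1) (x : X) :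
    p.maxValue g x ≤ (((d + K) * κ x : ℝ) : EReal) := by
  have := maxValue_le_add (p := p) (κ := κ) (g₁ := g) (g₂ := fun _ => 0) (K := K)
    (fun q => by simpa using h q) x
  rw [maxValue_zero] at this
  calc _ ≤ _ := this
    _ ≤ ((d * κ x : ℝ) : EReal) + ((K * κ x : ℝ) : EReal) := by gcongr; exact hG.rbar_le x
    _ = _ := by rw [← EReal.coe_add, add_mul]

theorem r_le_rbar (q : p.D) : p.r q ≤ p.rbar q.1.1 :=
  le_iSup (fun a : p.Γ q.1.1 => p.r ⟨(q.1.1, a.1), a.2⟩) ⟨q.1.2, q.2⟩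

theorem r_add_le_maxValue (g : p.D → ℝ) (q : p.D) :
    p.r q + (g q : EReal) ≤ p.maxValue g q.1.1 :=
  le_iSup (fun a : p.Γ q.1.1 => p.r ⟨(q.1.1, a.1), a.2⟩ + (g ⟨(q.1.1, a.1), a.2⟩ : EReal))
    ⟨q.1.2, q.2⟩

end MaxValue

section Operator

variable {p : DynProg X A} {κ : X → ℝ} {d α ℓ : ℝ}

theorem GrowthCondition.lintegral_le (hG : p.GrowthCondition κ d α) (q : p.D) :
    ∫⁻ x, ENNReal.ofReal (κ x) ∂(p.Q q) ≤ ENNReal.ofReal (α * κ q.1.1) := by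
  have h := hG.expect_le q
  rw [expect_of_nonneg (fun x => by exact_mod_cast (zero_le_one.trans (hG.one_le x)))] at h
  simp only [EReal.real_coe_toENNReal] at h
  rw [← EReal.coe_ennreal_le_coe_ennreal_iff, EReal.coe_ennreal_ofReal]
  exact h.trans (by exact_mod_cast le_max_left _ _)

theorem GrowthCondition.integrable (hG : p.GrowthCondition κ d α) (q : p.D) :
    Integrable κ (p.Q q) := by
  refine ⟨hG.measurable.aestronglyMeasurable, ?_⟩
  rw [hasFiniteIntegral_iff_ofReal
    (Eventually.of_forall fun x => zero_le_one.trans (hG.one_le x))]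
  exact (hG.lintegral_le q).trans_lt ENNReal.ofReal_lt_top

theorem GrowthCondition.integral_le (hG : p.GrowthCondition κ d α) (q : p.D) :
    ∫ x, κ x ∂(p.Q q) ≤ α * κ q.1.1 := by
  have h := hG.expect_le q
  rw [expect_coe (hG.integrable q)] at h
  exact_mod_cast h

theorem lintegral_toENNReal_ne_top {Ω : Type*} [MeasurableSpace Ω] {μ : Measure Ω} {u : Ω → EReal}
    {f : Ω → ℝ} (hf : Integrable f μ) (h : ∀ x, u x ≤ (f x : EReal)) :
    ∫⁻ x, (u x).toENNReal ∂μ ≠ ∞ :=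
  ((lintegral_mono fun x => EReal.toENNReal_le_toENNReal (h x)).trans_lt
    hf.lintegral_lt_top).ne

theorem expect_add_coe {Ω : Type*} [MeasurableSpace Ω] {μ : Measure Ω} {u : Ω → EReal}
    {f g : Ω → ℝ} (hu : AEMeasurable u μ) (hg : Integrable g μ) (h : ∀ x, u x ≤ (g x : EReal))
    (hf : Integrable f μ) :
    expect μ (fun x => u x + (f x : EReal)) = expect μ u + ((∫ x, f x ∂μ : ℝ) : EReal) := by
  rw [expect_add hu hf.aemeasurable.coe_real_ereal (lintegral_toENNReal_ne_top hg h)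
    (lintegral_toENNReal_ne_top hf fun _ => le_rfl), expect_coe hf]

namespace Regular

theorem mul_lt_one (h : p.Regular κ d α ℓ) : α * p.β < 1 := by
  have := h.growth.α_lt
  rwa [lt_div_iff₀ h.β_pos] at this

theorem mul_pos (h : p.Regular κ d α ℓ) : 0 < α * p.β := _root_.mul_pos h.growth.α_pos h.β_pos

/-- The gain from taking expectations last: `maxValue g` may be `⊥` at some states, while its
expectation has a uniform real lower bound. -/
theorem le_expect_maxValue (h : p.Regular κ d α ℓ) {g : p.D → ℝ} {c : ℝ} (hc : ∀ q, c ≤ g q)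
    (q : p.D) : ((ℓ + c : ℝ) : EReal) ≤ expect (p.Q q) (p.maxValue g) := by
  have := h.markov
  calc ((ℓ + c : ℝ) : EReal) ≤ expect (p.Q q) p.rbar + (c : EReal) := by
        rw [EReal.coe_add]; gcongr; exact h.le_expect_rbar q
    _ = expect (p.Q q) (fun x => p.rbar x + (c : EReal)) := by
        rw [expect_add_coe (f := fun _ => c) h.measurable_rbar.aemeasurable
          ((h.growth.integrable q).const_mul d) h.growth.rbar_le (integrable_const c)]
        simp
    _ ≤ _ := expect_mono fun x => rbar_add_le_maxValue hc x

theorem expect_maxValue_le (h : p.Regular κ d α ℓ) {g : p.D → ℝ} {K : ℝ} (hK : 0 ≤ K)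
    (hg : ∀ q, g q ≤ K * κ q.1.1) (q : p.D) :
    expect (p.Q q) (p.maxValue g) ≤ (((d + K) * (α * κ q.1.1) : ℝ) : EReal) := by
  refine (expect_mono fun x => maxValue_le h.growth hg x).trans ?_
  rw [expect_coe ((h.growth.integrable q).const_mul _), integral_const_mul]
  exact_mod_cast mul_le_mul_of_nonneg_left (h.growth.integral_le q)
    (add_nonneg h.growth.d_nonneg hK)

/-- The bounds that define the weighted space, with explicit constants. -/
theorem bounds (h : p.Regular κ d α ℓ) {g : p.D → ℝ} (hg : g ∈ p.weightedSpace κ) :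
    ∃ c K : ℝ, 0 ≤ K ∧ (∀ q, c ≤ g q) ∧ ∀ q, |g q| ≤ K * κ q.1.1 := by
  obtain ⟨_, ⟨c, hc⟩, hn⟩ := hg
  exact ⟨c, _, ENNReal.toReal_nonneg, hc, abs_le_toReal_wnorm h.growth.one_le hn⟩

theorem expect_maxValue_ne (h : p.Regular κ d α ℓ) {g : p.D → ℝ} (hg : g ∈ p.weightedSpace κ)
    (q : p.D) : expect (p.Q q) (p.maxValue g) ≠ ⊥ ∧ expect (p.Q q) (p.maxValue g) ≠ ⊤ := by
  obtain ⟨c, K, hK, hc, hgK⟩ := h.bounds hg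
  exact ⟨ne_bot_of_le_ne_bot (EReal.coe_ne_bot _) (h.le_expect_maxValue hc q),
    ne_top_of_le_ne_top (EReal.coe_ne_top _)
      (h.expect_maxValue_le hK (fun q => (le_abs_self _).trans (hgK q)) q)⟩

/-- `toReal` sends `⊥` and `⊤` to `0`, so the real operator is faithful only after both values are
excluded. -/
theorem coe_S (_h : p.Regular κ d α ℓ) {g : p.D → ℝ} {q : p.D}
    (h1 : expect (p.Q q) (p.maxValue g) ≠ ⊥) (h2 : expect (p.Q q) (p.maxValue g) ≠ ⊤) :
    (p.S g q : EReal) = p.SE g q ∧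
      p.S g q = p.β * (expect (p.Q q) (p.maxValue g)).toReal := by
  rw [S, SE]
  lift expect (p.Q q) (p.maxValue g) to ℝ using ⟨h2, h1⟩ with e
  norm_cast

theorem S_ge (h : p.Regular κ d α ℓ) {g : p.D → ℝ} (hg : g ∈ p.weightedSpace κ) {c : ℝ}
    (hc : ∀ q, c ≤ g q) (q : p.D) : p.β * (ℓ + c) ≤ p.S g q := by
  obtain ⟨h1, h2⟩ := h.expect_maxValue_ne hg q
  rw [(h.coe_S h1 h2).2]
  refine mul_le_mul_of_nonneg_left ?_ h.β_pos.le
  have := h.le_expect_maxValue hc q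
  rw [← EReal.coe_toReal h2 h1] at this
  exact_mod_cast this

theorem S_le (h : p.Regular κ d α ℓ) {g : p.D → ℝ} (hg : g ∈ p.weightedSpace κ) {K : ℝ}
    (hK : 0 ≤ K) (hgK : ∀ q, g q ≤ K * κ q.1.1) (q : p.D) :
    p.S g q ≤ p.β * ((d + K) * (α * κ q.1.1)) := by
  obtain ⟨h1, h2⟩ := h.expect_maxValue_ne hg q
  rw [(h.coe_S h1 h2).2]
  refine mul_le_mul_of_nonneg_left ?_ h.β_pos.le
  have := h.expect_maxValue_le hK hgK q
  rw [← EReal.coe_toReal h2 h1] at this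
  exact_mod_cast this

theorem exists_le_S (h : p.Regular κ d α ℓ) {g : p.D → ℝ} (hg : g ∈ p.weightedSpace κ) :
    ∃ c : ℝ, ∀ q, c ≤ p.S g q := by
  obtain ⟨c, K, hK, hc, hgK⟩ := h.bounds hg
  exact ⟨_, h.S_ge hg hc⟩

theorem wnorm_S_lt_top (h : p.Regular κ d α ℓ) {g : p.D → ℝ} (hg : g ∈ p.weightedSpace κ) :
    p.wnorm κ (p.S g) < ∞ := by
  obtain ⟨c, K, hK, hc, hgK⟩ := h.bounds hg
  refine (wnorm_le_ofReal h.growth.one_le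
    (K := |p.β * (ℓ + c)| + p.β * ((d + K) * α)) fun q => ?_).trans_lt ENNReal.ofReal_lt_top
  have h1 := h.S_ge hg hc q
  have h2 := h.S_le hg hK (fun q => (le_abs_self _).trans (hgK q)) q
  have h3 := h.growth.one_le q.1.1
  have h4 : 0 ≤ p.β * ((d + K) * α) := mul_nonneg h.β_pos.le
    (mul_nonneg (add_nonneg h.growth.d_nonneg hK) h.growth.α_pos.le)
  have h5 : |p.β * (ℓ + c)| ≤ |p.β * (ℓ + c)| * κ q.1.1 :=
    le_mul_of_one_le_right (abs_nonneg _) h3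
  have h6 := neg_abs_le (p.β * (ℓ + c))
  have h7 := mul_nonneg h4 (zero_le_one.trans h3)
  have h8 : p.β * ((d + K) * (α * κ q.1.1)) = p.β * ((d + K) * α) * κ q.1.1 := by ring
  rw [add_mul, abs_le]
  constructor <;> linarith [abs_nonneg (p.β * (ℓ + c))]

theorem measurable_S (_h : p.Regular κ d α ℓ) {g : p.D → ℝ} (hm : Measurable (p.maxValue g)) :
    Measurable (p.S g) :=
  ((measurable_expect p.Q.measurable hm).const_mul _).ereal_toReal

theorem aemeasurable_S (h : p.Regular κ d α ℓ) {g : p.D → ℝ} (hg : Measurable g)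
    (ρ : Measure p.D) [IsFiniteMeasure ρ] : AEMeasurable (p.S g) ρ := by
  have := h.markov
  -- Universal measurability is used for the mixture of the kernel over `ρ`: a property that holds
  -- almost everywhere for the mixture holds `p.Q q`-almost everywhere for `ρ`-almost every `q`.
  have hm := h.aemeasurable_maxValue g hg (ρ.bind p.Q) inferInstance
  refine ⟨fun q => ((p.β : EReal) * expect (p.Q q) (hm.mk _)).toReal,
    ((measurable_expect p.Q.measurable hm.measurable_mk).const_mul _).ereal_toReal, ?_⟩
  filter_upwards [Measure.ae_ae_of_ae_comp hm.ae_eq_mk] with q hq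
  rw [S, SE, expect_congr_ae hq]

theorem S_mem (h : p.Regular κ d α ℓ) {g : p.D → ℝ} (hg : g ∈ p.weightedSpace κ)
    (hm : Measurable (p.maxValue g)) : p.S g ∈ p.weightedSpace κ :=
  ⟨h.measurable_S hm, h.exists_le_S hg, h.wnorm_S_lt_top hg⟩

/-- The contraction estimate; measurability is needed for one of the two functions only. -/
theorem abs_S_sub_le (h : p.Regular κ d α ℓ) {g₁ g₂ : p.D → ℝ} (hg : g₁ ∈ p.weightedSpace κ)
    {K : ℝ} (hK : 0 ≤ K) (hd : ∀ q, |g₁ q - g₂ q| ≤ K * κ q.1.1) (q : p.D) :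
    |p.S g₁ q - p.S g₂ q| ≤ α * p.β * K * κ q.1.1 := by
  have := h.markov
  obtain ⟨h1, h2⟩ := h.expect_maxValue_ne hg q
  obtain ⟨c, K₁, hK₁, hc, hgK⟩ := h.bounds hg
  have hm := h.aemeasurable_maxValue g₁ hg.1 (p.Q q) inferInstance
  have hint := h.growth.integrable q
  have hup : ∀ x, p.maxValue g₁ x ≤ (((d + K₁) * κ x : ℝ) : EReal) :=
    maxValue_le h.growth fun q => (le_abs_self _).trans (hgK q)
  have key : ∀ e : ℝ, expect (p.Q q) (fun x => p.maxValue g₁ x + ((e * κ x : ℝ) : EReal)) =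
      expect (p.Q q) (p.maxValue g₁) + ((e * ∫ x, κ x ∂(p.Q q) : ℝ) : EReal) := fun e => by
    rw [expect_add_coe hm (hint.const_mul _) hup (hint.const_mul e), integral_const_mul]
  have hub : expect (p.Q q) (p.maxValue g₂) ≤
      expect (p.Q q) (p.maxValue g₁) + ((K * ∫ x, κ x ∂(p.Q q) : ℝ) : EReal) := by
    rw [← key]
    exact expect_mono fun x => maxValue_le_add (fun q => by
      have := (abs_le.1 (hd q)).1; linarith) x
  have hlb : expect (p.Q q) (p.maxValue g₁) + ((-K * ∫ x, κ x ∂(p.Q q) : ℝ) : EReal) ≤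
      expect (p.Q q) (p.maxValue g₂) := by
    rw [← key]
    refine expect_mono fun x => ?_
    calc _ ≤ (p.maxValue g₂ x + ((K * κ x : ℝ) : EReal)) + ((-K * κ x : ℝ) : EReal) := by
          gcongr
          exact maxValue_le_add (fun q => by have := (abs_le.1 (hd q)).2; linarith) x
      _ = p.maxValue g₂ x := by rw [add_assoc, ← EReal.coe_add]; simp
  have hI := h.growth.integral_le q
  have e1 := (h.coe_S h1 h2).2
  lift expect (p.Q q) (p.maxValue g₁) to ℝ using ⟨h2, h1⟩ with a ha
  -- Nothing but its distance to `g₁` is known about `g₂`; the two bounds force its expectation to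
  -- be finite.
  have hb1 : expect (p.Q q) (p.maxValue g₂) ≠ ⊥ := ne_bot_of_le_ne_bot (by
    rw [← EReal.coe_add]; exact EReal.coe_ne_bot _) hlb
  have hb2 : expect (p.Q q) (p.maxValue g₂) ≠ ⊤ := ne_top_of_le_ne_top (by
    rw [← EReal.coe_add]; exact EReal.coe_ne_top _) hub
  have e2 := (h.coe_S hb1 hb2).2
  lift expect (p.Q q) (p.maxValue g₂) to ℝ using ⟨hb2, hb1⟩ with b hb
  rw [EReal.toReal_coe] at e1 e2
  have hub' : b ≤ a + K * ∫ x, κ x ∂(p.Q q) := by exact_mod_cast hub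
  have hlb' : a + -K * ∫ x, κ x ∂(p.Q q) ≤ b := by exact_mod_cast hlb
  have hKI := mul_le_mul_of_nonneg_left hI hK
  rw [e1, e2, ← mul_sub, abs_mul, abs_of_pos h.β_pos]
  have : |a - b| ≤ K * (α * κ q.1.1) := abs_le.2 ⟨by linarith, by linarith⟩
  calc p.β * |a - b| ≤ p.β * (K * (α * κ q.1.1)) := mul_le_mul_of_nonneg_left this h.β_pos.le
    _ = _ := by ring

theorem wnorm_S_sub_le (h : p.Regular κ d α ℓ) {g₁ g₂ : p.D → ℝ} (hg : g₁ ∈ p.weightedSpace κ)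
    (hd : p.wnorm κ (g₁ - g₂) < ∞) :
    p.wnorm κ (p.S g₁ - p.S g₂) ≤ ENNReal.ofReal (α * p.β) * p.wnorm κ (g₁ - g₂) := by
  rw [← ENNReal.ofReal_toReal hd.ne, ← ENNReal.ofReal_mul h.mul_pos.le]
  exact wnorm_le_ofReal h.growth.one_le fun q => h.abs_S_sub_le hg ENNReal.toReal_nonneg
    (fun q => by simpa using abs_le_toReal_wnorm h.growth.one_le hd q) q

theorem wnorm_sub_lt_top (h : p.Regular κ d α ℓ) {g₁ g₂ : p.D → ℝ} (hg₁ : p.wnorm κ g₁ < ∞)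
    (hg₂ : p.wnorm κ g₂ < ∞) : p.wnorm κ (g₁ - g₂) < ∞ := by
  refine (wnorm_le_ofReal h.growth.one_le
    (K := (p.wnorm κ g₁).toReal + (p.wnorm κ g₂).toReal) fun q => ?_).trans_lt ENNReal.ofReal_lt_top
  rw [add_mul]
  exact (abs_sub _ _).trans (add_le_add (abs_le_toReal_wnorm h.growth.one_le hg₁ q)
    (abs_le_toReal_wnorm h.growth.one_le hg₂ q))

/-- Iterates of the operator converge geometrically to a fixed point, from every starting point at
finite distance. -/
theorem wnorm_iterate_sub_le (h : p.Regular κ d α ℓ) {g gs : p.D → ℝ}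
    (hgs : gs ∈ p.weightedSpace κ) (hfix : p.S gs = gs) {C : ℝ} (hC : 0 ≤ C)
    (hd : ∀ q, |gs q - g q| ≤ C * κ q.1.1) (n : ℕ) :
    ∀ q, |gs q - (p.S)^[n] g q| ≤ C * (α * p.β) ^ n * κ q.1.1 := by
  induction n with
  | zero => simpa using hd
  | succ n ih =>
    intro q
    -- The fixed point takes the slot that asks for measurability, since the iterates of `g` may
    -- fail to be Borel.
    have := h.abs_S_sub_le hgs (mul_nonneg hC (pow_nonneg h.mul_pos.le n)) ih q
    rw [hfix] at this
    rw [Function.iterate_succ_apply']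
    exact this.trans_eq (by ring)

theorem eq_of_fixed (h : p.Regular κ d α ℓ) {g gs : p.D → ℝ} (hgs : gs ∈ p.weightedSpace κ)
    (hfix : p.S gs = gs) (hg : g ∈ p.weightedSpace κ) (hg' : p.S g = g) : g = gs := by
  have hlt := h.wnorm_sub_lt_top hgs.2.2 hg.2.2
  funext q
  have hb := fun n => h.wnorm_iterate_sub_le (g := g) hgs hfix ENNReal.toReal_nonneg
    (fun q => by simpa using abs_le_toReal_wnorm h.growth.one_le hlt q) n q
  simp only [Function.iterate_fixed hg'] at hb
  have ht : Tendsto (fun n : ℕ => (p.wnorm κ (gs - g)).toReal * (α * p.β) ^ n * κ q.1.1) atTop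
      (𝓝 0) := by
    simpa using ((tendsto_pow_atTop_nhds_zero_of_lt_one h.mul_pos.le h.mul_lt_one).const_mul
      (p.wnorm κ (gs - g)).toReal).mul_const (κ q.1.1)
  have := ge_of_tendsto' ht hb
  have := abs_nonpos_iff.1 this
  linarith

/-- The contraction principle on a closed invariant subset of the weighted space. -/
theorem exists_fixed (h : p.Regular κ d α ℓ) {G : Set (p.D → ℝ)} (hG : G ⊆ p.weightedSpace κ)
    (hclosed : ∀ g ∈ p.weightedSpace κ, ∀ u : ℕ → p.D → ℝ, (∀ n, u n ∈ G) →
      Tendsto (fun n => p.wnorm κ (u n - g)) atTop (𝓝 0) → g ∈ G)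
    (hS : ∀ g ∈ G, p.S g ∈ G) (h0 : (fun _ => 0) ∈ G) : ∃ gs ∈ G, p.S gs = gs := by
  set ρ := α * p.β with hρ
  let u : ℕ → p.D → ℝ := fun n => (p.S)^[n] (fun _ => 0)
  have hu : ∀ n, u n ∈ G := fun n => by
    induction n with
    | zero => exact h0
    | succ n ih => simp only [u, Function.iterate_succ_apply']; exact hS _ ih
  have husucc : ∀ n, u (n + 1) = p.S (u n) := fun n => Function.iterate_succ_apply' _ _ _
  obtain ⟨c₁, C, hC, -, hCb⟩ := h.bounds (hG (hu 1))
  have hstep : ∀ n q, |u n q - u (n + 1) q| ≤ C * ρ ^ n * κ q.1.1 := by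
    intro n
    induction n with
    | zero => intro q; simpa [u] using hCb q
    | succ n ih =>
      intro q
      have := h.abs_S_sub_le (hG (hu n)) (mul_nonneg hC (pow_nonneg h.mul_pos.le n)) ih q
      rw [husucc n, husucc (n + 1), husucc n]
      rw [husucc n] at this
      exact this.trans_eq (by rw [← hρ]; ring)
  have hdist : ∀ q n, dist (u n q) (u (n + 1) q) ≤ C * κ q.1.1 * ρ ^ n := fun q n => by
    rw [Real.dist_eq]; exact (hstep n q).trans_eq (by ring)
  have hlim : ∀ q, ∃ a, Tendsto (fun n => u n q) atTop (𝓝 a) := fun q =>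
    cauchySeq_tendsto_of_complete (cauchySeq_of_le_geometric ρ _ h.mul_lt_one (hdist q))
  choose gs hgs using hlim
  have herr : ∀ n q, |u n q - gs q| ≤ (C / (1 - ρ) * ρ ^ n) * κ q.1.1 := fun n q => by
    have := dist_le_of_le_geometric_of_tendsto ρ _ h.mul_lt_one (hdist q) (hgs q) n
    rw [Real.dist_eq] at this
    exact this.trans_eq (by ring)
  -- Weighted convergence bounds the limit only by multiples of `κ`, so boundedness below needs its
  -- own invariant. The constant `c` is chosen with `c ≤ 0` and `c ≤ β (ℓ + c)`.
  have hlow : ∃ c : ℝ, ∀ n q, c ≤ u n q := by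
    refine ⟨min 0 (p.β * ℓ / (1 - p.β)), fun n => ?_⟩
    induction n with
    | zero => intro q; exact min_le_left _ _
    | succ n ih =>
      intro q
      rw [husucc]
      refine le_trans ?_ (h.S_ge (hG (hu n)) ih q)
      have hβ := h.β_pos
      have hβ1 : 0 < 1 - p.β := sub_pos.2 h.β_lt_one
      have h1 := min_le_right 0 (p.β * ℓ / (1 - p.β))
      rw [le_div_iff₀ hβ1] at h1
      linarith
  obtain ⟨c, hc⟩ := hlow
  have hgsw : gs ∈ p.weightedSpace κ := by
    refine ⟨measurable_of_tendsto_metrizable (fun n => (hG (hu n)).1) (tendsto_pi_nhds.2 hgs),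
      ⟨c, fun q => ge_of_tendsto' (hgs q) fun n => hc n q⟩, ?_⟩
    refine (wnorm_le_ofReal h.growth.one_le (K := C / (1 - ρ)) fun q => ?_).trans_lt
      ENNReal.ofReal_lt_top
    simpa [u] using herr 0 q
  have hpow : Tendsto (fun n : ℕ => C / (1 - ρ) * ρ ^ n) atTop (𝓝 0) := by
    simpa using (tendsto_pow_atTop_nhds_zero_of_lt_one h.mul_pos.le h.mul_lt_one).const_mul
      (C / (1 - ρ))
  refine ⟨gs, hclosed gs hgsw u hu ?_, ?_⟩
  · have ht := ENNReal.tendsto_ofReal hpow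
    rw [ENNReal.ofReal_zero] at ht
    exact tendsto_of_tendsto_of_tendsto_of_le_of_le tendsto_const_nhds ht (fun _ => zero_le)
      fun n => wnorm_le_ofReal h.growth.one_le (herr n)
  · funext q
    -- The shifted iterates `S (u n)` tend to `gs` by construction and to `S gs` by the contraction
    -- estimate.
    refine tendsto_nhds_unique ?_ ((tendsto_add_atTop_iff_nat 1).2 (hgs q))
    rw [tendsto_iff_dist_tendsto_zero]
    have ht : Tendsto (fun n : ℕ => ρ * (C / (1 - ρ) * ρ ^ n) * κ q.1.1) atTop (𝓝 0) := by
      simpa using (hpow.const_mul ρ).mul_const (κ q.1.1)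
    refine squeeze_zero (fun _ => dist_nonneg) (fun n => ?_) ht
    rw [Real.dist_eq, husucc]
    exact h.abs_S_sub_le (hG (hu n)) (mul_nonneg (div_nonneg hC (sub_pos.2 h.mul_lt_one).le)
      (pow_nonneg h.mul_pos.le n)) (herr n) q

end Regular

end Operator

end DynProg

/-! ### Values of policies and the verification argument. -/

section Series

/-- The partial sums of `a - b` decrease, hence converge in the extended reals to a limit at most
`0`; the convergent real series of `b` is then added back. -/
theorem EReal.exists_tendsto_sum_of_le {a : ℕ → EReal} {b : ℕ → ℝ} (hab : ∀ n, a n ≤ (b n : EReal))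
    (hb : Summable b) :
    ∃ L : EReal, L < ⊤ ∧ Tendsto (fun n => ∑ t ∈ Finset.range n, a t) atTop (𝓝 L) := by
  let C : ℕ → EReal := fun n => ∑ t ∈ Finset.range n, (a t - (b t : EReal))
  have hneg : ∀ t, a t - (b t : EReal) ≤ 0 := fun t => EReal.sub_nonpos.2 (hab t)
  have hC : Antitone C := antitone_nat_of_succ_le fun n => by
    simp only [C, Finset.sum_range_succ]
    exact (add_le_add_right (hneg n) _).trans_eq (add_zero _)
  have hsum : ∀ n, ∑ t ∈ Finset.range n, a t =
      C n + ((∑ t ∈ Finset.range n, b t : ℝ) : EReal) := fun n => by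
    induction n with
    | zero => simp [C]
    | succ n ih =>
      have : C (n + 1) = C n + (a n - (b n : EReal)) := Finset.sum_range_succ _ _
      rw [Finset.sum_range_succ, ih, this, Finset.sum_range_succ, EReal.coe_add]
      rw [add_add_add_comm, EReal.sub_add_cancel]
  refine ⟨(⨅ n, C n) + ((∑' t, b t : ℝ) : EReal), ?_, ?_⟩
  · refine EReal.add_lt_top (ne_top_of_le_ne_top EReal.zero_ne_top ?_) (EReal.coe_ne_top _)
    exact (iInf_le C 0).trans (by simp [C])
  · simp only [hsum]
    have h1 : Tendsto C atTop (𝓝 (⨅ n, C n)) := tendsto_atTop_iInf hC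
    have h2 : Tendsto (fun n => ((∑ t ∈ Finset.range n, b t : ℝ) : EReal)) atTop
        (𝓝 ((∑' t, b t : ℝ) : EReal)) := EReal.tendsto_coe.2 hb.hasSum.tendsto_sum_nat
    exact (EReal.continuousAt_add (p := (⨅ n, C n, ((∑' t, b t : ℝ) : EReal)))
      (Or.inr (EReal.coe_ne_bot _)) (Or.inr (EReal.coe_ne_top _))).tendsto.comp
      (h1.prodMk_nhds h2)

end Series

namespace DynProg

variable {X A : Type*} [MeasurableSpace X] [MeasurableSpace A]
  {p : DynProg X A} {κ : X → ℝ} {d α ℓ : ℝ}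

theorem Policy.measurable_pair (σ : p.Policy) : Measurable σ.pair :=
  (measurable_id.prodMk σ.measurable).subtype_mk

namespace Regular

theorem measurable_kernel (_h : p.Regular κ d α ℓ) (σ : p.Policy) :
    Measurable fun y => p.Q (σ.pair y) := p.Q.measurable.comp σ.measurable_pair

theorem isProbabilityMeasure_stateLaw (h : p.Regular κ d α ℓ) (σ : p.Policy) (x : X) (t : ℕ) :
    IsProbabilityMeasure (p.stateLaw σ x t) := by
  have := h.markov
  induction t with
  | zero => exact Measure.dirac.isProbabilityMeasure
  | succ t ih =>
    exact isProbabilityMeasure_bind (h.measurable_kernel σ).aemeasurable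
      (Eventually.of_forall fun y => inferInstance)

theorem lintegral_stateLaw_le (h : p.Regular κ d α ℓ) (σ : p.Policy) (x : X) (t : ℕ) :
    ∫⁻ y, ENNReal.ofReal (κ y) ∂(p.stateLaw σ x t) ≤ ENNReal.ofReal (α ^ t * κ x) := by
  induction t with
  | zero => simp [stateLaw, lintegral_dirac' _ h.growth.measurable.ennreal_ofReal]
  | succ t ih =>
    rw [stateLaw, Measure.lintegral_bind (h.measurable_kernel σ).aemeasurable
      h.growth.measurable.ennreal_ofReal.aemeasurable]
    calc ∫⁻ y, ∫⁻ z, ENNReal.ofReal (κ z) ∂(p.Q (σ.pair y)) ∂(p.stateLaw σ x t)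
        ≤ ∫⁻ y, ENNReal.ofReal α * ENNReal.ofReal (κ y) ∂(p.stateLaw σ x t) :=
          lintegral_mono fun y => (h.growth.lintegral_le (σ.pair y)).trans_eq
            (ENNReal.ofReal_mul h.growth.α_pos.le)
      _ = ENNReal.ofReal α * ∫⁻ y, ENNReal.ofReal (κ y) ∂(p.stateLaw σ x t) :=
          lintegral_const_mul _ h.growth.measurable.ennreal_ofReal
      _ ≤ ENNReal.ofReal α * ENNReal.ofReal (α ^ t * κ x) := by gcongr
      _ = _ := by rw [← ENNReal.ofReal_mul h.growth.α_pos.le]; congr 1; ring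

theorem integrable_stateLaw (h : p.Regular κ d α ℓ) (σ : p.Policy) (x : X) (t : ℕ) :
    Integrable κ (p.stateLaw σ x t) := by
  refine ⟨h.growth.measurable.aestronglyMeasurable, ?_⟩
  rw [hasFiniteIntegral_iff_ofReal
    (Eventually.of_forall fun x => zero_le_one.trans (h.growth.one_le x))]
  exact (h.lintegral_stateLaw_le σ x t).trans_lt ENNReal.ofReal_lt_top

theorem integral_stateLaw_le (h : p.Regular κ d α ℓ) (σ : p.Policy) (x : X) (t : ℕ) :
    ∫ y, κ y ∂(p.stateLaw σ x t) ≤ α ^ t * κ x := by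
  have h0 : ∀ y, 0 ≤ κ y := fun y => zero_le_one.trans (h.growth.one_le y)
  have := h.lintegral_stateLaw_le σ x t
  rw [← ofReal_integral_eq_lintegral_ofReal (h.integrable_stateLaw σ x t)
    (Eventually.of_forall h0)] at this
  exact (ENNReal.ofReal_le_ofReal_iff (mul_nonneg (pow_nonneg h.growth.α_pos.le t) (h0 x))).1 this

theorem expect_stateLaw_le (h : p.Regular κ d α ℓ) (σ : p.Policy) (x : X) (t : ℕ)
    {v : X → EReal} {K : ℝ} (hK : 0 ≤ K) (hv : ∀ y, v y ≤ ((K * κ y : ℝ) : EReal)) :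
    expect (p.stateLaw σ x t) v ≤ ((K * (α ^ t * κ x) : ℝ) : EReal) := by
  refine (expect_mono hv).trans ?_
  rw [expect_coe ((h.integrable_stateLaw σ x t).const_mul _), integral_const_mul]
  exact_mod_cast mul_le_mul_of_nonneg_left (h.integral_stateLaw_le σ x t) hK

theorem reward_le (h : p.Regular κ d α ℓ) (σ : p.Policy) (y : X) :
    p.r (σ.pair y) ≤ ((d * κ y : ℝ) : EReal) :=
  (r_le_rbar (σ.pair y)).trans (h.growth.rbar_le y)

theorem coe_mul_le_coe {c b : ℝ} {a : EReal} (hc : 0 ≤ c) (h : a ≤ (b : EReal)) :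
    (c : EReal) * a ≤ ((c * b : ℝ) : EReal) := by
  rw [EReal.coe_mul]
  exact mul_le_mul_of_nonneg_left h (by exact_mod_cast hc)

theorem tendsto_partialValue (h : p.Regular κ d α ℓ) (σ : p.Policy) (x : X) :
    Tendsto (p.partialValue σ x) atTop (𝓝 (p.policyValue σ x)) ∧ p.policyValue σ x < ⊤ := by
  obtain ⟨L, hL, hlim⟩ := EReal.exists_tendsto_sum_of_le
    (a := fun t => ((p.β ^ t : ℝ) : EReal) *
      expect (p.stateLaw σ x t) (fun y => p.r (σ.pair y)))
    (b := fun t => (α * p.β) ^ t * (d * κ x)) (fun t => by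
      refine (coe_mul_le_coe (pow_nonneg h.β_pos.le t)
        (h.expect_stateLaw_le σ x t h.growth.d_nonneg (h.reward_le σ))).trans_eq ?_
      congr 1; rw [mul_pow]; ring)
    ((summable_geometric_of_lt_one h.mul_pos.le h.mul_lt_one).mul_right _)
  have : p.policyValue σ x = L := Tendsto.liminf_eq hlim
  rw [this]
  exact ⟨hlim, hL⟩

/-- One step of the state process, for functions with a weighted upper bound. -/
theorem expect_stateLaw_succ (h : p.Regular κ d α ℓ) (σ : p.Policy) (x : X) (t : ℕ)
    {v : X → EReal} (hm : Measurable v) {K : ℝ} (hv : ∀ y, v y ≤ ((K * κ y : ℝ) : EReal)) :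
    expect (p.stateLaw σ x (t + 1)) v =
      expect (p.stateLaw σ x t) fun y => expect (p.Q (σ.pair y)) v :=
  expect_bind (h.measurable_kernel σ) hm
    (lintegral_toENNReal_ne_top ((h.integrable_stateLaw σ x (t + 1)).const_mul K) hv)

theorem add_expect_stateLaw (h : p.Regular κ d α ℓ) (σ : p.Policy) (x : X) (t : ℕ)
    {v : X → EReal} (hm : Measurable v) {K : ℝ} (hK : 0 ≤ K)
    (hv : ∀ y, v y ≤ ((K * κ y : ℝ) : EReal)) :
    expect (p.stateLaw σ x t) (fun y => p.r (σ.pair y)) +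
        (p.β : EReal) * expect (p.stateLaw σ x (t + 1)) v =
      expect (p.stateLaw σ x t)
        (fun y => p.r (σ.pair y) + (p.β : EReal) * expect (p.Q (σ.pair y)) v) := by
  have hme : Measurable fun y => expect (p.Q (σ.pair y)) v :=
    measurable_expect (h.measurable_kernel σ) hm
  have hint := h.integrable_stateLaw σ x t
  rw [h.expect_stateLaw_succ σ x t hm hv, ← expect_const_mul h.β_pos.le _ hme.aemeasurable]
  refine (expect_add (h.measurable_r.comp σ.measurable_pair).aemeasurable
    (hme.const_mul _).aemeasurable (lintegral_toENNReal_ne_top (hint.const_mul d) (h.reward_le σ))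
    (lintegral_toENNReal_ne_top (hint.const_mul (p.β * (K * α))) fun y => ?_)).symm
  have : expect (p.Q (σ.pair y)) v ≤ ((K * (α * κ y) : ℝ) : EReal) := by
    refine (expect_mono hv).trans ?_
    rw [expect_coe ((h.growth.integrable _).const_mul _), integral_const_mul]
    exact_mod_cast mul_le_mul_of_nonneg_left (h.growth.integral_le _) hK
  exact (coe_mul_le_coe h.β_pos.le this).trans_eq (by congr 1; ring)

/-- Value of the first `T` periods plus the discounted expectation of `v` at time `T`. -/
theorem partialValue_succ_add (h : p.Regular κ d α ℓ) (σ : p.Policy) (x : X) (T : ℕ)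
    {v : X → EReal} (hm : Measurable v) {K : ℝ} (hK : 0 ≤ K)
    (hv : ∀ y, v y ≤ ((K * κ y : ℝ) : EReal)) :
    p.partialValue σ x (T + 1) +
        ((p.β ^ (T + 1) : ℝ) : EReal) * expect (p.stateLaw σ x (T + 1)) v =
      p.partialValue σ x T + ((p.β ^ T : ℝ) : EReal) * expect (p.stateLaw σ x T)
        (fun y => p.r (σ.pair y) + (p.β : EReal) * expect (p.Q (σ.pair y)) v) := by
  rw [partialValue, Finset.sum_range_succ, ← h.add_expect_stateLaw σ x T hm hK hv, add_assoc,
    EReal.left_distrib_of_nonneg_of_ne_top (by exact_mod_cast pow_nonneg h.β_pos.le T)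
      (EReal.coe_ne_top _), ← mul_assoc, ← EReal.coe_mul, ← pow_succ]
  rfl

theorem tendsto_discounted (h : p.Regular κ d α ℓ) (σ : p.Policy) (x : X)
    {v : X → EReal} (hm : Measurable v) {K c : ℝ} (hK : 0 ≤ K)
    (hv : ∀ y, v y ≤ ((K * κ y : ℝ) : EReal)) (hc : ∀ q, (c : EReal) ≤ expect (p.Q q) v) :
    Tendsto (fun T => ((p.β ^ T : ℝ) : EReal) * expect (p.stateLaw σ x T) v) atTop (𝓝 0) := by
  -- The index is shifted because the lower bound `c` holds only after a transition; at time `0` the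
  -- expectation is `v x`, possibly `⊥`.
  refine (tendsto_add_atTop_iff_nat 1).1 ?_
  have hlo : Tendsto (fun T : ℕ => ((p.β ^ (T + 1) * c : ℝ) : EReal)) atTop (𝓝 0) := by
    have := ((tendsto_add_atTop_iff_nat 1).2
      (tendsto_pow_atTop_nhds_zero_of_lt_one h.β_pos.le h.β_lt_one)).mul_const c
    rw [zero_mul] at this
    exact EReal.tendsto_coe.2 this
  have hhi : Tendsto (fun T : ℕ => ((K * κ x * (α * p.β) ^ (T + 1) : ℝ) : EReal)) atTop (𝓝 0) := by
    have := ((tendsto_add_atTop_iff_nat 1).2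
      (tendsto_pow_atTop_nhds_zero_of_lt_one h.mul_pos.le h.mul_lt_one)).const_mul (K * κ x)
    rw [mul_zero] at this
    exact EReal.tendsto_coe.2 this
  refine tendsto_of_tendsto_of_tendsto_of_le_of_le hlo hhi (fun T => ?_) (fun T => ?_)
  · have := h.isProbabilityMeasure_stateLaw σ x T
    simp only []
    rw [EReal.coe_mul, h.expect_stateLaw_succ σ x T hm hv]
    refine mul_le_mul_of_nonneg_left ?_ (by exact_mod_cast pow_nonneg h.β_pos.le (T + 1))
    exact (expect_const (μ := p.stateLaw σ x T) c).symm.le.trans (expect_mono fun y => hc _)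
  · refine (coe_mul_le_coe (pow_nonneg h.β_pos.le _)
      (h.expect_stateLaw_le σ x (T + 1) hK hv)).trans_eq ?_
    congr 1; rw [mul_pow]; ring

theorem tendsto_partialValue_add (h : p.Regular κ d α ℓ) (σ : p.Policy) (x : X)
    {v : X → EReal} (hm : Measurable v) {K c : ℝ} (hK : 0 ≤ K)
    (hv : ∀ y, v y ≤ ((K * κ y : ℝ) : EReal)) (hc : ∀ q, (c : EReal) ≤ expect (p.Q q) v) :
    Tendsto (fun T => p.partialValue σ x T +
      ((p.β ^ T : ℝ) : EReal) * expect (p.stateLaw σ x T) v) atTop (𝓝 (p.policyValue σ x)) := by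
  have := (EReal.continuousAt_add (p := (p.policyValue σ x, (0 : EReal)))
    (Or.inr EReal.zero_ne_bot) (Or.inr EReal.zero_ne_top)).tendsto.comp
    ((h.tendsto_partialValue σ x).1.prodMk_nhds (h.tendsto_discounted σ x hm hK hv hc))
  rw [add_zero] at this
  exact this

section Verification

variable {gs : p.D → ℝ}

theorem coe_fixed (h : p.Regular κ d α ℓ) (hg : gs ∈ p.weightedSpace κ) (hfix : p.S gs = gs)
    (q : p.D) : (gs q : EReal) = (p.β : EReal) * expect (p.Q q) (p.maxValue gs) := by
  obtain ⟨h1, h2⟩ := h.expect_maxValue_ne hg q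
  have := (h.coe_S h1 h2).1
  rwa [hfix] at this

/-- The value of any policy is at most the maximal one-step value, via the value of deviating from
the second period on. -/
theorem policyValue_le_pair (h : p.Regular κ d α ℓ) (hg : gs ∈ p.weightedSpace κ)
    (hfix : p.S gs = gs) (hm : Measurable (p.maxValue gs)) (σ : p.Policy) (x : X) :
    p.policyValue σ x ≤ p.r (σ.pair x) + (gs (σ.pair x) : EReal) := by
  obtain ⟨c, K, hK, hc, hgK⟩ := h.bounds hg
  have hv := maxValue_le (p := p) h.growth fun q => (le_abs_self _).trans (hgK q)
  have hdK := add_nonneg h.growth.d_nonneg hK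
  have hlim := h.tendsto_partialValue_add σ x hm hdK hv (h.le_expect_maxValue hc)
  have hanti : Antitone fun T => p.partialValue σ x T +
      ((p.β ^ T : ℝ) : EReal) * expect (p.stateLaw σ x T) (p.maxValue gs) := by
    refine antitone_nat_of_succ_le fun T => ?_
    rw [h.partialValue_succ_add σ x T hm hdK hv]
    refine add_le_add_right (mul_le_mul_of_nonneg_left (expect_mono fun y => ?_)
      (by exact_mod_cast pow_nonneg h.β_pos.le T)) _
    rw [← h.coe_fixed hg hfix]
    exact r_add_le_maxValue gs (σ.pair y)
  -- The term `T = 1` is used rather than `T = 0`: it keeps the action chosen at `x`, so that an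
  -- optimal policy is seen to be greedy.
  refine (hanti.le_of_tendsto hlim 1).trans_eq ?_
  have := h.partialValue_succ_add σ x 0 hm hdK hv
  simp only [zero_add] at this
  rw [this]
  simp only [partialValue, Finset.range_zero, Finset.sum_empty, zero_add, pow_zero,
    EReal.coe_one, one_mul, stateLaw]
  rw [h.coe_fixed hg hfix]
  exact expect_dirac ((h.measurable_r.comp σ.measurable_pair).add
    ((measurable_expect (h.measurable_kernel σ) hm).const_mul _)) x

/-- For a greedy policy the sequence that decreases in general is constant, so its limit is its term
at `T = 0`. -/
theorem policyValue_of_isGreedy (h : p.Regular κ d α ℓ) (hg : gs ∈ p.weightedSpace κ)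
    (hfix : p.S gs = gs) (hm : Measurable (p.maxValue gs)) {σ : p.Policy} (hσ : p.IsGreedy gs σ)
    (x : X) : p.policyValue σ x = p.maxValue gs x := by
  obtain ⟨c, K, hK, hc, hgK⟩ := h.bounds hg
  have hv := maxValue_le (p := p) h.growth fun q => (le_abs_self _).trans (hgK q)
  have hdK := add_nonneg h.growth.d_nonneg hK
  have hlim := h.tendsto_partialValue_add σ x hm hdK hv (h.le_expect_maxValue hc)
  have hconst : ∀ T, p.partialValue σ x T +
      ((p.β ^ T : ℝ) : EReal) * expect (p.stateLaw σ x T) (p.maxValue gs) = p.maxValue gs x := by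
    intro T
    induction T with
    | zero => simp [partialValue, stateLaw, expect_dirac hm]
    | succ T ih =>
      rw [h.partialValue_succ_add σ x T hm hdK hv, ← ih]
      congr 3
      funext y
      rw [← h.coe_fixed hg hfix]
      exact hσ y
  simp only [hconst] at hlim
  exact tendsto_nhds_unique hlim tendsto_const_nhds

theorem value_eq (h : p.Regular κ d α ℓ) (hg : gs ∈ p.weightedSpace κ)
    (hfix : p.S gs = gs) (hm : Measurable (p.maxValue gs)) {σ : p.Policy} (hσ : p.IsGreedy gs σ) :
    p.value = p.maxValue gs := by
  funext x
  refine le_antisymm (iSup_le fun τ => ?_) ?_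
  · exact (h.policyValue_le_pair hg hfix hm τ x).trans (r_add_le_maxValue gs (τ.pair x))
  · rw [← h.policyValue_of_isGreedy hg hfix hm hσ x]
    exact le_iSup (fun τ : p.Policy => p.policyValue τ x) σ

theorem isOptimal_iff_isGreedy (h : p.Regular κ d α ℓ) (hg : gs ∈ p.weightedSpace κ)
    (hfix : p.S gs = gs) (hm : Measurable (p.maxValue gs)) {σ : p.Policy} (hσ : p.IsGreedy gs σ)
    (τ : p.Policy) : p.IsOptimal τ ↔ p.IsGreedy gs τ := by
  have hval := h.value_eq hg hfix hm hσ
  refine ⟨fun hτ x => ?_, fun hτ x => ?_⟩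
  · refine le_antisymm (r_add_le_maxValue gs (τ.pair x)) ?_
    rw [← hval, ← hτ x]
    exact h.policyValue_le_pair hg hfix hm τ x
  · rw [hval, h.policyValue_of_isGreedy hg hfix hm hτ x]

theorem isGreatest_value (h : p.Regular κ d α ℓ) (hg : gs ∈ p.weightedSpace κ)
    (hfix : p.S gs = gs) (hm : Measurable (p.maxValue gs)) {σ : p.Policy} (hσ : p.IsGreedy gs σ)
    (x : X) : IsGreatest (Set.range fun a : p.Γ x =>
      p.r ⟨(x, a.1), a.2⟩ + (gs ⟨(x, a.1), a.2⟩ : EReal)) (p.value x) := by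
  rw [h.value_eq hg hfix hm hσ]
  refine ⟨⟨⟨σ.toFun x, σ.feasible x⟩, hσ x⟩, ?_⟩
  rintro _ ⟨a, rfl⟩
  exact r_add_le_maxValue gs ⟨(x, a.1), a.2⟩

end Verification

end Regular

end DynProg

/-! ### Continuity of expectations under Feller kernels. -/

section Feller

/-- Near `s₀` the values are squeezed by monotonicity between those at one fixed point on each side,
where continuity in `z` alone suffices. -/
theorem continuous_of_monotone_of_separately {Z : Type*} [TopologicalSpace Z] {F : Z × ℝ≥0 → ℝ}
    (hmono : ∀ z, Monotone fun s => F (z, s)) (hz : ∀ s, Continuous fun z => F (z, s))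
    (hs : ∀ z, Continuous fun s => F (z, s)) : Continuous F := by
  rw [continuous_iff_continuousAt]
  rintro ⟨z₀, s₀⟩
  refine tendsto_order.2 ⟨fun a ha => ?_, fun a ha => ?_⟩
  · have h1 : {s | a < F (z₀, s)} ∈ 𝓝 s₀ := (hs z₀).continuousAt.eventually (lt_mem_nhds ha)
    obtain ⟨s₁, h1a, h1s⟩ : ∃ s₁, a < F (z₀, s₁) ∧ Set.Ici s₁ ∈ 𝓝 s₀ := by
      -- At the left endpoint nothing lies below, but `Set.Ici 0` is itself a neighbourhood of `0`.
      rcases eq_or_ne s₀ 0 with rfl | h0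
      · exact ⟨0, ha, by simp⟩
      · obtain ⟨l, hl, hsub⟩ := exists_Ioc_subset_of_mem_nhds h1 ⟨0, pos_iff_ne_zero.2 h0⟩
        obtain ⟨s₁, hls, hs₁⟩ := exists_between hl
        exact ⟨s₁, hsub ⟨hls, hs₁.le⟩, Ici_mem_nhds hs₁⟩
    have h2 := (hz s₁).continuousAt.eventually (lt_mem_nhds h1a)
    filter_upwards [h2.prod_nhds h1s] with q hq
    exact hq.1.trans_le (hmono q.1 hq.2)
  · have h1 : {s | F (z₀, s) < a} ∈ 𝓝 s₀ := (hs z₀).continuousAt.eventually (gt_mem_nhds ha)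
    obtain ⟨u, hu, hsub⟩ := exists_Ico_subset_of_mem_nhds h1 ⟨s₀ + 1, by simp⟩
    obtain ⟨s₁, hs₁, hsu⟩ := exists_between hu
    have h2 := (hz s₁).continuousAt.eventually (gt_mem_nhds (hsub ⟨hs₁.le, hsu⟩))
    filter_upwards [h2.prod_nhds (Iic_mem_nhds hs₁)] with q hq
    exact (hmono q.1 hq.2).trans_lt hq.1

variable {Z E : Type*} [TopologicalSpace Z] [TopologicalSpace.PseudoMetrizableSpace Z]
  [MeasurableSpace Z] [BorelSpace Z] [MeasurableSpace E] {P : Kernel Z Z} [IsMarkovKernel P]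

/-- The Feller property says that `z ↦ P z` is weakly continuous; this is the portmanteau inequality
for open sets. -/
theorem feller_le_liminf_measure_open
    (hP : ∀ u : BoundedContinuousFunction Z ℝ, Continuous fun z => ∫ z', u z' ∂(P z))
    (z₀ : Z) {U : Set Z} (hU : IsOpen U) : P z₀ U ≤ liminf (fun z => P z U) (𝓝 z₀) := by
  let _ := TopologicalSpace.pseudoMetrizableSpacePseudoMetric Z
  let μs : Z → ProbabilityMeasure Z := fun z => ⟨P z, inferInstance⟩
  have ht : Tendsto μs (𝓝 z₀) (𝓝 (μs z₀)) :=
    ProbabilityMeasure.tendsto_iff_forall_integral_tendsto.2 fun u => (hP u).tendsto z₀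
  exact ProbabilityMeasure.le_liminf_measure_open_of_tendsto ht hU

/-- A Feller kernel maps nonnegative lower semicontinuous functions to lower semicontinuous
functions. -/
theorem feller_lowerSemicontinuous_lintegral
    (hP : ∀ u : BoundedContinuousFunction Z ℝ, Continuous fun z => ∫ z', u z' ∂(P z))
    {G : Z → ℝ≥0∞} (hG : LowerSemicontinuous G) :
    LowerSemicontinuous fun z => ∫⁻ z', G z' ∂(P z) := by
  let _ := TopologicalSpace.pseudoMetrizableSpacePseudoMetric Z
  have hm : Measurable G := hG.measurable
  intro z₀
  refine lowerSemicontinuousAt_iff_le_liminf.2 ?_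
  have trunc : ∀ n : ℕ, ∫⁻ z', min (G z') n ∂(P z₀) ≤
      liminf (fun z => ∫⁻ z', G z' ∂(P z)) (𝓝 z₀) := by
    intro n
    have hfin : ∀ z', min (G z') n ≠ ∞ := fun z' =>
      ((min_le_right _ _).trans_lt (ENNReal.natCast_lt_top n)).ne
    -- Layer-cake formula: superlevel sets of a lower semicontinuous function are open, so the
    -- portmanteau inequality applies at each level and Fatou's lemma integrates over levels.
    -- Truncation makes `toReal` lossless.
    have e : ∀ z, ∫⁻ z', min (G z') n ∂(P z) =
        ∫⁻ t in Set.Ioi (0 : ℝ), P z {z' | t < (min (G z') n).toReal} := fun z => by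
      rw [← lintegral_eq_lintegral_meas_lt (P z)
        (Eventually.of_forall fun z' => ENNReal.toReal_nonneg)
        (hm.min measurable_const).ennreal_toReal.aemeasurable]
      exact lintegral_congr fun z' => (ENNReal.ofReal_toReal (hfin z')).symm
    calc ∫⁻ z', min (G z') n ∂(P z₀)
        = ∫⁻ t in Set.Ioi (0 : ℝ), P z₀ {z' | t < (min (G z') n).toReal} := e z₀
      _ ≤ ∫⁻ t in Set.Ioi (0 : ℝ),
            liminf (fun z => P z {z' | t < (min (G z') n).toReal}) (𝓝 z₀) := by
          refine setLIntegral_mono' measurableSet_Ioi fun t ht => ?_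
          refine feller_le_liminf_measure_open hP z₀ ?_
          have : {z' | t < (min (G z') n).toReal} =
              {z' | ENNReal.ofReal t < G z'} ∩ {_z' | ENNReal.ofReal t < n} := by
            ext z'
            simp only [Set.mem_ofPred_eq, Set.mem_inter_iff, ← lt_min_iff]
            rw [ENNReal.ofReal_lt_iff_lt_toReal (le_of_lt ht) (hfin z')]
          rw [this]
          exact (hG.isOpen_preimage _).inter isOpen_const
      _ ≤ liminf (fun z => ∫⁻ t in Set.Ioi (0 : ℝ), P z {z' | t < (min (G z') n).toReal})
            (𝓝 z₀) := by
          refine lintegral_liminf_le fun z => ?_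
          exact Antitone.measurable fun s t hst => measure_mono fun z' hz' => lt_of_le_of_lt hst hz'
      _ ≤ _ := by
          refine liminf_le_liminf (Eventually.of_forall fun z => ?_)
          simp only [← e z]
          exact lintegral_mono fun z' => min_le_left _ _
  have hsup : ∀ z', ⨆ n : ℕ, min (G z') n = G z' := fun z' => by
    rw [← inf_iSup_eq, ENNReal.iSup_natCast, inf_top_eq]
  calc ∫⁻ z', G z' ∂(P z₀) = ∫⁻ z', ⨆ n : ℕ, min (G z') n ∂(P z₀) := by simp only [hsup]
    _ = ⨆ n : ℕ, ∫⁻ z', min (G z') n ∂(P z₀) :=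
        lintegral_iSup (fun n => hm.min measurable_const)
          fun m n hmn z' => min_le_min_left _ (by exact_mod_cast hmn)
    _ ≤ _ := iSup_le trunc

/-- Fatou's lemma in `ε` makes the inner integral lower semicontinuous in `z`, and the previous
result applies. Semicontinuity is needed only for each fixed `ε`. -/
theorem feller_prod_lowerSemicontinuous_lintegral {φ : Measure E} [IsProbabilityMeasure φ]
    (hP : ∀ u : BoundedContinuousFunction Z ℝ, Continuous fun z => ∫ z', u z' ∂(P z))
    {G : Z × E → ℝ≥0∞} (hm : Measurable G)
    (hG : ∀ ε, LowerSemicontinuous fun z => G (z, ε)) :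
    LowerSemicontinuous fun z => ∫⁻ u, G u ∂((P z).prod φ) := by
  let _ := TopologicalSpace.pseudoMetrizableSpacePseudoMetric Z
  simp only [lintegral_prod _ hm.aemeasurable]
  refine feller_lowerSemicontinuous_lintegral hP fun z₀ => ?_
  refine lowerSemicontinuousAt_iff_le_liminf.2 ?_
  calc ∫⁻ ε, G (z₀, ε) ∂φ ≤ ∫⁻ ε, liminf (fun z => G (z, ε)) (𝓝 z₀) ∂φ :=
        lintegral_mono fun ε => lowerSemicontinuousAt_iff_le_liminf.1 (hG ε z₀)
    _ ≤ _ := lintegral_liminf_le fun z => hm.comp measurable_prodMk_left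

/-- Subtraction is continuous away from equal infinities; there the difference is `⊥`, its positive
part is `0`, and lower semicontinuity at a minimum is trivial. -/
theorem EReal.lowerSemicontinuousAt_toENNReal_sub {Z : Type*} [TopologicalSpace Z] {v l : Z → EReal} {z : Z}
    (hv : ContinuousAt v z) (hl : ContinuousAt l z) :
    LowerSemicontinuousAt (fun z => (v z - l z).toENNReal) z := by
  by_cases h : (v z = ⊤ ∧ l z = ⊤) ∨ (v z = ⊥ ∧ l z = ⊥)
  · intro y hy
    exfalso
    rcases h with ⟨h1, h2⟩ | ⟨h1, h2⟩ <;> simp [h1, h2, sub_eq_add_neg] at hy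
  · push Not at h
    have : ContinuousAt (fun z => v z - l z) z := by
      simp only [sub_eq_add_neg]
      refine (EReal.continuousAt_add (p := (v z, -l z)) ?_ ?_).comp
        (f := fun z => (v z, -l z)) (hv.prodMk hl.neg)
      · by_cases h' : v z = ⊤
        · exact Or.inr fun h2 => h.1 h' (EReal.neg_eq_bot_iff.1 h2)
        · exact Or.inl h'
      · by_cases h' : v z = ⊥
        · exact Or.inr fun h2 => h.2 h' (EReal.neg_eq_top_iff.1 h2)
        · exact Or.inl h'
    exact this.ereal_toENNReal.lowerSemicontinuousAt

theorem expect_neg {Ω : Type*} [MeasurableSpace Ω] {μ : Measure Ω} {u : Ω → EReal}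
    (hb : expect μ u ≠ ⊥) : expect μ (fun x => -u x) = -expect μ u := by
  have h2 : ((∫⁻ x, (-u x).toENNReal ∂μ : ℝ≥0∞) : EReal) ≠ ⊤ := fun h =>
    hb (by rw [expect, h, EReal.sub_top])
  rw [expect, expect, EReal.neg_sub (Or.inl (by simp)) (Or.inr h2)]
  simp only [neg_neg]
  rw [sub_eq_add_neg, add_comm]

/-- The expectation of `v` is lower semicontinuous if `v` is bounded below by a function with
continuous expectations. Continuity of the integrands is needed on a set of full measure only. -/
theorem feller_lowerSemicontinuous_expect {φ : Measure E} [IsProbabilityMeasure φ]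
    (hP : ∀ u : BoundedContinuousFunction Z ℝ, Continuous fun z => ∫ z', u z' ∂(P z))
    {l v : Z × E → EReal} (hlm : Measurable l) (hvm : Measurable v) (hlv : ∀ u, l u ≤ v u)
    {O : Set (Z × E)} (hOm : MeasurableSet O) (hO : ∀ ε, IsOpen {z | (z, ε) ∈ O})
    (hOae : ∀ z, ∀ᵐ u ∂((P z).prod φ), u ∈ O)
    (hl : ∀ u ∈ O, ContinuousAt (fun z => l (z, u.2)) u.1)
    (hv : ∀ u ∈ O, ContinuousAt (fun z => v (z, u.2)) u.1)
    (hlf : ∀ z, expect ((P z).prod φ) l ≠ ⊥ ∧ expect ((P z).prod φ) l ≠ ⊤)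
    (hvf : ∀ z, expect ((P z).prod φ) v ≠ ⊥ ∧ expect ((P z).prod φ) v ≠ ⊤)
    (hlc : Continuous fun z => expect ((P z).prod φ) l) :
    LowerSemicontinuous fun z => expect ((P z).prod φ) v := by
  -- The value `0` off `O` is the least possible and the slices of `O` are open, so the cut-off
  -- keeps lower semicontinuity; it changes no integral because `O` has full measure.
  let G : Z × E → ℝ≥0∞ := O.indicator fun u => (v u - l u).toENNReal
  have hsubm : Measurable fun u => v u - l u := by
    simp only [sub_eq_add_neg]; exact hvm.add hlm.neg
  have hGm : Measurable G := hsubm.ereal_toENNReal.indicator hOm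
  have hGl : ∀ ε, LowerSemicontinuous fun z => G (z, ε) := by
    intro ε z
    by_cases hz : (z, ε) ∈ O
    · have := EReal.lowerSemicontinuousAt_toENNReal_sub (hv _ hz) (hl _ hz)
      intro y hy
      simp only [G, Set.indicator_of_mem hz] at hy
      filter_upwards [this y hy, (hO ε).mem_nhds hz] with z' h1 h2
      simp only [G]
      rw [Set.indicator_of_mem h2]; exact h1
    · intro y hy
      simp [G, Set.indicator_of_notMem hz] at hy
  have hG := feller_prod_lowerSemicontinuous_lintegral (φ := φ) hP hGm hGl
  have key : ∀ z, expect ((P z).prod φ) v =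
      expect ((P z).prod φ) l + ((∫⁻ u, G u ∂((P z).prod φ) : ℝ≥0∞) : EReal) := by
    intro z
    obtain ⟨hl1, hl2⟩ := integrable_toReal_of_expect_ne hlm.aemeasurable (hlf z).1 (hlf z).2
    obtain ⟨hv1, hv2⟩ := integrable_toReal_of_expect_ne hvm.aemeasurable (hvf z).1 (hvf z).2
    have hle : 0 ≤ᵐ[(P z).prod φ] fun u => (v u).toReal - (l u).toReal := by
      filter_upwards [hl1, hv1] with u h1 h2
      have := hlv u
      rw [← h1, ← h2] at this
      exact sub_nonneg.2 (by exact_mod_cast this)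
    have e : ∫⁻ u, G u ∂((P z).prod φ) =
        ENNReal.ofReal (∫ u, ((v u).toReal - (l u).toReal) ∂((P z).prod φ)) := by
      rw [ofReal_integral_eq_lintegral_ofReal (f := fun u => (v u).toReal - (l u).toReal)
        (hv2.sub hl2) hle]
      refine lintegral_congr_ae ?_
      filter_upwards [hl1, hv1, hOae z] with u h1 h2 h3
      simp only [G, Set.indicator_of_mem h3]
      conv_lhs => rw [← h1, ← h2, ← EReal.coe_sub, EReal.real_coe_toENNReal]
    rw [e, EReal.coe_ennreal_ofReal, max_eq_left (integral_nonneg_of_ae hle),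
      expect_eq_integral_toReal hlm.aemeasurable (hlf z).1 (hlf z).2,
      expect_eq_integral_toReal hvm.aemeasurable (hvf z).1 (hvf z).2, integral_sub hv2 hl2]
    norm_cast
    ring
  simp only [key]
  refine hlc.lowerSemicontinuous.add' (continuous_coe_ennreal_ereal.comp_lowerSemicontinuous
    hG EReal.coe_ennreal_strictMono.monotone) fun z => ?_
  exact EReal.continuousAt_add (Or.inl (hlf z).2) (Or.inl (hlf z).1)

/-- A generalized dominated convergence: the measures vary too, so a dominating function is replaced
by envelopes with continuous expectations. The lower one gives lower semicontinuity, and the same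
argument for `-w ≤ -v` gives upper semicontinuity. -/
theorem feller_continuous_expect {φ : Measure E} [IsProbabilityMeasure φ]
    (hP : ∀ u : BoundedContinuousFunction Z ℝ, Continuous fun z => ∫ z', u z' ∂(P z))
    {l v w : Z × E → EReal} (hlm : Measurable l) (hvm : Measurable v) (hwm : Measurable w)
    (hlv : ∀ u, l u ≤ v u) (hvw : ∀ u, v u ≤ w u)
    {O : Set (Z × E)} (hOm : MeasurableSet O) (hO : ∀ ε, IsOpen {z | (z, ε) ∈ O})
    (hOae : ∀ z, ∀ᵐ u ∂((P z).prod φ), u ∈ O)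
    (hl : ∀ u ∈ O, ContinuousAt (fun z => l (z, u.2)) u.1)
    (hv : ∀ u ∈ O, ContinuousAt (fun z => v (z, u.2)) u.1)
    (hw : ∀ u ∈ O, ContinuousAt (fun z => w (z, u.2)) u.1)
    (hlf : ∀ z, expect ((P z).prod φ) l ≠ ⊥) (hwf : ∀ z, expect ((P z).prod φ) w ≠ ⊤)
    (hlc : Continuous fun z => expect ((P z).prod φ) l)
    (hwc : Continuous fun z => expect ((P z).prod φ) w) :
    Continuous fun z => expect ((P z).prod φ) v := by
  have h1 : ∀ z, expect ((P z).prod φ) l ≤ expect ((P z).prod φ) v := fun z => expect_mono hlv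
  have h2 : ∀ z, expect ((P z).prod φ) v ≤ expect ((P z).prod φ) w := fun z => expect_mono hvw
  have hvb : ∀ z, expect ((P z).prod φ) v ≠ ⊥ := fun z => ne_bot_of_le_ne_bot (hlf z) (h1 z)
  have hvt : ∀ z, expect ((P z).prod φ) v ≠ ⊤ := fun z => ne_top_of_le_ne_top (hwf z) (h2 z)
  have hwb : ∀ z, expect ((P z).prod φ) w ≠ ⊥ := fun z => ne_bot_of_le_ne_bot (hvb z) (h2 z)
  have hlt : ∀ z, expect ((P z).prod φ) l ≠ ⊤ := fun z => ne_top_of_le_ne_top (hvt z) (h1 z)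
  refine continuous_iff_lower_upperSemicontinuous.2 ⟨?_, ?_⟩
  · exact feller_lowerSemicontinuous_expect hP hlm hvm hlv hOm hO hOae hl hv
      (fun z => ⟨hlf z, hlt z⟩) (fun z => ⟨hvb z, hvt z⟩) hlc
  · have := feller_lowerSemicontinuous_expect (φ := φ) hP (l := fun u => -w u)
      (v := fun u => -v u) hwm.neg hvm.neg (fun u => EReal.neg_le_neg_iff.2 (hvw u)) hOm hO hOae
      (fun u hu => (hw u hu).neg) (fun u hu => (hv u hu).neg)
      (fun z => by rw [expect_neg (hwb z)]; simp [hwb z, hwf z])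
      (fun z => by rw [expect_neg (hvb z)]; simp [hvb z, hvt z])
      (by simp only [fun z => expect_neg (hwb z)]; exact hwc.neg)
    simp only [fun z => expect_neg (hvb z)] at this
    intro z y hy
    filter_upwards [this z (-y) (EReal.neg_lt_neg_iff.2 hy)] with z' hz'
    exact EReal.neg_lt_neg_iff.1 hz'

end Feller

theorem Continuous.ereal_add_coe {T : Type*} [TopologicalSpace T] {u : T → EReal} {g : T → ℝ}
    (hu : Continuous u) (hg : Continuous g) : Continuous fun t => u t + (g t : EReal) := by
  rw [continuous_iff_continuousAt]
  intro t
  exact (EReal.continuousAt_add (p := (u t, (g t : EReal))) (Or.inr (EReal.coe_ne_bot _))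
    (Or.inr (EReal.coe_ne_top _))).comp (f := fun t => (u t, (g t : EReal)))
    (hu.continuousAt.prodMk (continuous_coe_real_ereal.comp hg).continuousAt)

theorem ContinuousOn.ereal_add_coe {T : Type*} [TopologicalSpace T] {u : T → EReal} {g : T → ℝ}
    {s : Set T} (hu : ContinuousOn u s) (hg : Continuous g) :
    ContinuousOn (fun t => u t + (g t : EReal)) s := by
  rw [continuousOn_iff_continuous_domRestrict] at hu ⊢
  exact hu.ereal_add_coe (hg.comp continuous_subtype_val)

/-! ### Continuity of the reward and measurable maximization. -/

namespace SavingsProblem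

section Basic

variable {Z N E : Type*} [MeasurableSpace Z] [MeasurableSpace E] {M : SavingsProblem Z N E}

/-- The wealth levels at which the reward is continuous. -/
def contSet (M : SavingsProblem Z N E) : Set ℝ≥0 :=
  {w | w = 0 → ContinuousWithinAt (fun q : ℝ≥0 × ℝ≥0 => M.r q.1 q.2) region (0, 0)}

theorem isOpen_contSet (M : SavingsProblem Z N E) : IsOpen M.contSet := by
  by_cases h : ContinuousWithinAt (fun q : ℝ≥0 × ℝ≥0 => M.r q.1 q.2) region (0, 0)
  · convert isOpen_univ
    ext w; simp [contSet, h]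
  · have : M.contSet = {0}ᶜ := by ext w; simp [contSet, h]
    rw [this]; exact isOpen_compl_singleton

theorem contSet_mono {w w' : ℝ≥0} (hw : w ∈ M.contSet) (h : w ≤ w') : w' ∈ M.contSet := by
  rintro rfl
  exact hw (le_antisymm h bot_le)

theorem eq_zero_of_notMem_contSet {w : ℝ≥0} (hw : w ∉ M.contSet) : w = 0 := by
  by_contra h
  exact hw fun h' => absurd h' h

/-- The largest one-step value when savings are restricted to `[0, b w]`. -/
noncomputable def cutValue (M : SavingsProblem Z N E) (g : Z × ℝ≥0 → ℝ) (b : ℝ≥0 → ℝ≥0) (x : ℝ≥0 × Z) : EReal :=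
  ⨆ s : Set.Iic (b x.1), M.r x.1 s + (g (x.2, s) : EReal)

theorem maxValue_eq_cutValue {g : Z × ℝ≥0 → ℝ} {g' : M.dp.D → ℝ}
    (h : ∀ q : M.dp.D, g' q = g (q.1.1.2, q.1.2)) :
    M.dp.maxValue g' = M.cutValue g id := by
  funext x
  simp only [DynProg.maxValue, h]
  rfl

/-- The next state as a function of savings and the pair `(z', ε')`. -/
def next (M : SavingsProblem Z N E) (s : ℝ≥0) (u : Z × E) : ℝ≥0 × Z := (M.f (s, M.h u), u.1)

/-- A state-action pair with given exogenous state and savings. -/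
def pairOf (M : SavingsProblem Z N E) (z : Z) (s : ℝ≥0) : M.dp.D :=
  ⟨((s, z), s), Set.mem_Iic.2 le_rfl⟩

theorem le_cutValue {g : Z × ℝ≥0 → ℝ} {c : ℝ} (hc : ∀ y, c ≤ g y) (x : ℝ≥0 × Z) :
    M.r x.1 0 + (c : EReal) ≤ M.cutValue g id x := by
  refine le_iSup_of_le ⟨0, Set.mem_Iic.2 bot_le⟩ ?_
  gcongr
  exact_mod_cast hc _

end Basic

section Reward

variable {Z N E : Type*} [TopologicalSpace Z] [MeasurableSpace Z] [TopologicalSpace N]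
  [TopologicalSpace E] [MeasurableSpace E] {M : SavingsProblem Z N E}

/-- The delicate case is a diagonal point `(s, s)` at which `r s` tends to `⊥`. Some `s₀ < s` has `r
s s₀ < K`, interior continuity gives `r w₁ s₀ < K` for some `w₁ > s`, and monotonicity spreads this
over all feasible pairs with wealth below `w₁` and savings above `s₀`. At the origin no such `s₀`
exists. -/
theorem Admissible.reward_continuousWithinAt (hM : M.Admissible) {q : ℝ≥0 × ℝ≥0}
    (hq : q ∈ region) (h0 : q.1 ≠ 0) :
    ContinuousWithinAt (fun q : ℝ≥0 × ℝ≥0 => M.r q.1 q.2) region q := by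
  have hopen : IsOpen {q : ℝ≥0 × ℝ≥0 | q.2 < q.1} := isOpen_lt continuous_snd continuous_fst
  have hsub : {q : ℝ≥0 × ℝ≥0 | q.2 < q.1} ⊆ region := fun q hq => by
    simp only [Set.mem_ofPred_eq] at hq
    exact hq.le
  have hint : ∀ q : ℝ≥0 × ℝ≥0, q.2 < q.1 → ContinuousAt (fun q : ℝ≥0 × ℝ≥0 => M.r q.1 q.2) q :=
    fun q hlt => hM.r_cont_interior.continuousAt
      (isOpen_interior.mem_nhds (interior_maximal hsub hopen hlt))
  obtain ⟨w, s⟩ := q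
  rcases lt_or_eq_of_le (show s ≤ w from hq) with hlt | rfl
  · exact (hint _ hlt).continuousWithinAt
  by_cases hb : M.RewardBddBelow
  · exact hM.r_cont_of_bddBelow hb _ hq
  rcases hM.r_diag hb s with h | h
  swap
  · exact h
  have hbot : M.r s s = ⊥ := tendsto_nhds_unique (tendsto_pure_nhds (M.r s) s)
    (h.mono_left (pure_le_nhdsWithin Set.self_mem_Iic))
  change Tendsto _ _ (𝓝 (M.r s s))
  rw [hbot, EReal.tendsto_nhds_bot_iff_real]
  intro K
  have hs0 : 0 < s := pos_iff_ne_zero.2 h0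
  have : (𝓝[<] s).NeBot := nhdsLT_neBot_of_exists_lt ⟨0, hs0⟩
  obtain ⟨s₀, hs₀K, hs₀⟩ := (((h.mono_left (nhdsWithin_mono _ Set.Iio_subset_Iic_self)).eventually
    (gt_mem_nhds (EReal.bot_lt_coe K))).and self_mem_nhdsWithin).exists
  have hc : ContinuousAt (fun w => M.r w s₀) s :=
    (hint (s, s₀) hs₀).comp (f := fun w : ℝ≥0 => (w, s₀)) (by fun_prop)
  have : (𝓝[>] s).NeBot := nhdsGT_neBot_of_exists_gt ⟨s + 1, by simp⟩
  obtain ⟨w₁, hw₁K, hw₁⟩ := (((hc.eventually (gt_mem_nhds hs₀K)).filter_mono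
    nhdsWithin_le_nhds).and (self_mem_nhdsWithin (s := Set.Ioi s))).exists
  filter_upwards [mem_nhdsWithin_of_mem_nhds (prod_mem_nhds (Iio_mem_nhds hw₁) (Ioi_mem_nhds hs₀)),
    self_mem_nhdsWithin] with q hq1 hq2
  have h1 : q.1 ≤ w₁ := le_of_lt hq1.1
  have h2 : s₀ ≤ q.2 := le_of_lt hq1.2
  calc M.r q.1 q.2 ≤ M.r q.1 s₀ := hM.r_anti _ _ _ h2 hq2
    _ ≤ M.r w₁ s₀ := hM.r_mono _ _ _ (h2.trans hq2) h1
    _ < K := hw₁K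

/-- At the origin the limit alternative merely says `r 0 0 = ⊥`. Hence finite rewards at zero
savings, which hold almost surely when `lowerEll` is finite, put the next wealth in `contSet`. -/
theorem Admissible.mem_contSet_of_ne_bot (hM : M.Admissible) {w : ℝ≥0} (hw : M.r w 0 ≠ ⊥) :
    w ∈ M.contSet := by
  rintro rfl
  by_cases hb : M.RewardBddBelow
  · exact hM.r_cont_of_bddBelow hb _ (le_refl (0 : ℝ≥0))
  rcases hM.r_diag hb 0 with h | h
  · exact absurd (tendsto_nhds_unique (tendsto_pure_nhds (M.r 0) 0)
      (h.mono_left (pure_le_nhdsWithin Set.self_mem_Iic))) hw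
  · exact h

theorem Admissible.reward_continuousOn (hM : M.Admissible) :
    ContinuousOn (fun q : ℝ≥0 × ℝ≥0 => M.r q.1 q.2) (region ∩ Prod.fst ⁻¹' M.contSet) := by
  rintro ⟨w, s⟩ ⟨hq, hw⟩
  refine ContinuousWithinAt.mono ?_ Set.inter_subset_left
  rcases eq_or_ne w 0 with rfl | h0
  · obtain rfl : s = 0 := le_antisymm hq bot_le
    exact hw rfl
  · exact hM.reward_continuousWithinAt hq h0

theorem Admissible.reward_continuousOn_action (hM : M.Admissible) (w : ℝ≥0) :
    ContinuousOn (fun s => M.r w s) (Set.Iic w) := by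
  rcases eq_or_ne w 0 with rfl | h0
  · refine Set.Subsingleton.continuousOn (fun a ha b hb => ?_) _
    rw [le_antisymm (Set.mem_Iic.1 ha) bot_le, le_antisymm (Set.mem_Iic.1 hb) bot_le]
  · intro s hs
    exact (hM.reward_continuousWithinAt (q := (w, s)) hs h0).comp
      (f := fun s : ℝ≥0 => (w, s)) (by fun_prop) fun s hs => hs

theorem Admissible.continuous_next (hM : M.Admissible) :
    Continuous fun v : ℝ≥0 × (Z × E) => M.next v.1 v.2 :=
  (hM.continuous_f.comp (continuous_fst.prodMk (hM.continuous_h.comp continuous_snd))).prodMk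
    (continuous_fst.comp continuous_snd)

theorem Admissible.continuous_next_right (hM : M.Admissible) (s : ℝ≥0) : Continuous (M.next s) :=
  hM.continuous_next.comp (Continuous.prodMk_right s)

theorem Admissible.next_fst_mono (hM : M.Admissible) {s s' : ℝ≥0} (h : s ≤ s') (u : Z × E) :
    (M.next s u).1 ≤ (M.next s' u).1 := hM.monotone_f _ h

theorem Admissible.continuousAt_zero_reward (hM : M.Admissible) {w : ℝ≥0} (hw : w ∈ M.contSet) :
    ContinuousAt (fun w => M.r w 0) w := by
  have h1 : ContinuousOn (fun w => M.r w 0) M.contSet :=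
    hM.reward_continuousOn.comp (f := fun w : ℝ≥0 => (w, (0 : ℝ≥0))) (by fun_prop)
      fun w hw => ⟨(bot_le : (0 : ℝ≥0) ≤ w), hw⟩
  exact h1.continuousAt (M.isOpen_contSet.mem_nhds hw)

end Reward

section CutValue

variable {Z N E : Type*} [TopologicalSpace Z] [MeasurableSpace Z] [TopologicalSpace N]
  [TopologicalSpace E] [MeasurableSpace E] {M : SavingsProblem Z N E}

variable {g : Z × ℝ≥0 → ℝ} {b : ℝ≥0 → ℝ≥0}

/-- Writing savings as a fraction `θ` of `b w` turns the moving constraint into the fixed compact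
interval `[0, 1]`, over which suprema of jointly continuous functions are continuous. The `min θ 1`
keeps the pair feasible for every `θ`. -/
theorem Admissible.continuousOn_cutValue (hM : M.Admissible) (hg : Continuous g)
    (hb : Continuous b) (hbw : ∀ w, b w ≤ w) :
    ContinuousOn (M.cutValue g b) (Prod.fst ⁻¹' M.contSet) := by
  rw [continuousOn_iff_continuous_domRestrict]
  let F : (Prod.fst ⁻¹' M.contSet : Set (ℝ≥0 × Z)) → ℝ≥0 → EReal := fun x θ =>
    M.r x.1.1 (min θ 1 * b x.1.1) + (g (x.1.2, min θ 1 * b x.1.1) : EReal)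
  have hF : Continuous (Function.uncurry F) := by
    refine Continuous.ereal_add_coe ?_ (by fun_prop)
    refine hM.reward_continuousOn.comp_continuous (f := fun y :
      (Prod.fst ⁻¹' M.contSet : Set (ℝ≥0 × Z)) × ℝ≥0 => (y.1.1.1, min y.2 1 * b y.1.1.1))
      (by fun_prop) fun y => ⟨?_, y.1.2⟩
    calc min y.2 1 * b y.1.1.1 ≤ 1 * b y.1.1.1 := by gcongr; exact min_le_right _ _
      _ ≤ y.1.1.1 := by rw [one_mul]; exact hbw _
  convert (isCompact_Icc (a := (0 : ℝ≥0)) (b := 1)).continuous_sSup (f := F) hF using 1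
  funext x
  simp only [Set.domRestrict_apply, cutValue, sSup_image]
  refine le_antisymm (iSup_le fun s => ?_) (iSup₂_le fun θ hθ => ?_)
  · rcases eq_or_ne (b x.1.1) 0 with h0 | h0
    · have hs : s.1 = 0 := le_antisymm (s.2.trans_eq h0) bot_le
      refine le_iSup₂_of_le 0 ⟨le_rfl, zero_le_one⟩ ?_
      simp [F, hs]
    · have h1 : s.1 / b x.1.1 ≤ 1 := div_le_one_of_le₀ s.2 bot_le
      refine le_iSup₂_of_le (s.1 / b x.1.1) ⟨bot_le, h1⟩ ?_
      simp [F, min_eq_left h1, div_mul_cancel₀ _ h0]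
  · refine le_iSup_of_le ⟨min θ 1 * b x.1.1, ?_⟩ le_rfl
    calc min θ 1 * b x.1.1 ≤ 1 * b x.1.1 := by gcongr; exact min_le_right _ _
      _ = b x.1.1 := one_mul _

theorem Admissible.measurable_cutValue [SecondCountableTopology Z] [BorelSpace Z]
    (hM : M.Admissible) (hg : Continuous g) (hb : Continuous b) (hbw : ∀ w, b w ≤ w) :
    Measurable (M.cutValue g b) := by
  have hm : MeasurableSet (Prod.fst ⁻¹' M.contSet : Set (ℝ≥0 × Z)) :=
    measurable_fst M.isOpen_contSet.measurableSet
  refine measurable_of_restrict_of_restrict_compl hm ?_ ?_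
  · exact (continuousOn_iff_continuous_domRestrict.1
      (hM.continuousOn_cutValue hg hb hbw)).measurable
  -- Off `contSet` wealth is zero, so zero savings are the only choice.
  · have : (Prod.fst ⁻¹' M.contSet : Set (ℝ≥0 × Z))ᶜ.domRestrict (M.cutValue g b) =
        fun x => M.r 0 0 + (g (x.1.2, 0) : EReal) := by
      funext ⟨⟨w, z⟩, hx⟩
      obtain rfl : w = 0 := eq_zero_of_notMem_contSet hx
      have h0 : b 0 = 0 := le_antisymm (hbw 0) bot_le
      refine le_antisymm (iSup_le fun s => ?_)
        (le_iSup_of_le ⟨0, Set.mem_Iic.2 bot_le⟩ le_rfl)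
      have hs : s.1 = 0 := le_antisymm ((Set.mem_Iic.1 s.2).trans_eq h0) bot_le
      rw [hs]
    rw [this]
    exact ((hg.comp (continuous_snd.comp continuous_subtype_val |>.prodMk
      continuous_const)).measurable.coe_real_ereal).const_add _

theorem Admissible.exists_eq_cutValue (hM : M.Admissible) (hg : Continuous g)
    (hbw : ∀ w, b w ≤ w) (x : ℝ≥0 × Z) :
    ∃ s ≤ b x.1, M.r x.1 s + (g (x.2, s) : EReal) = M.cutValue g b x := by
  have hc : ContinuousOn (fun s => M.r x.1 s + (g (x.2, s) : EReal)) (Set.Iic (b x.1)) :=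
    ((hM.reward_continuousOn_action x.1).mono (Set.Iic_subset_Iic.2 (hbw _))).ereal_add_coe
      (by fun_prop)
  have hcomp : IsCompact (Set.Iic (b x.1)) := by
    rw [← Set.Icc_bot]; exact isCompact_Icc
  obtain ⟨s, hs, hmax⟩ := hcomp.exists_isMaxOn ⟨0, Set.mem_Iic.2 bot_le⟩ hc
  exact ⟨s, hs, le_antisymm (le_iSup_of_le ⟨s, hs⟩ le_rfl) (iSup_le fun t => hmax t.2)⟩

theorem Admissible.cutValue_mono (hM : M.Admissible) (z : Z) :
    Monotone fun w => M.cutValue g id (w, z) := by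
  intro w w' hw
  refine iSup_le fun s => le_iSup_of_le ⟨s.1, s.2.trans hw⟩ ?_
  exact add_le_add_left (hM.r_mono _ _ _ s.2 hw) _

/-- The smallest maximizer is a measurable selection. -/
theorem Admissible.exists_measurable_argmax [SecondCountableTopology Z] [BorelSpace Z]
    (hM : M.Admissible) (hg : Continuous g) : ∃ σ : ℝ≥0 × Z → ℝ≥0, Measurable σ ∧
      ∀ x, σ x ≤ x.1 ∧ M.r x.1 (σ x) + (g (x.2, σ x) : EReal) = M.cutValue g id x := by
  let B : ℝ≥0 × Z → Set ℝ≥0 := fun x =>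
    Set.Iic x.1 ∩ (fun s => M.r x.1 s + (g (x.2, s) : EReal)) ⁻¹' {M.cutValue g id x}
  have hmem : ∀ x, sInf (B x) ∈ B x := fun x => by
    refine IsClosed.csInf_mem ?_ ?_ (OrderBot.bddBelow _)
    · exact ((hM.reward_continuousOn_action x.1).ereal_add_coe
        (by fun_prop)).preimage_isClosed_of_isClosed isClosed_Iic isClosed_singleton
    · obtain ⟨s, hs, h⟩ := hM.exists_eq_cutValue hg (b := id) (fun w => le_rfl) x
      exact ⟨s, hs, h⟩
  refine ⟨fun x => sInf (B x), measurable_of_Iic fun c => ?_, fun x => hmem x⟩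
  -- The smallest maximizer is at most `c` exactly when capping savings at `c` does not lower the
  -- maximum, an equality of two measurable functions.
  have : (fun x => sInf (B x)) ⁻¹' Set.Iic c =
      {x | M.cutValue g (fun w => min w c) x = M.cutValue g id x} := by
    ext x
    simp only [Set.mem_preimage, Set.mem_Iic, Set.mem_ofPred_eq]
    constructor
    · intro h
      refine le_antisymm (iSup_le fun s => le_iSup_of_le
        ⟨s.1, Set.mem_Iic.2 ((Set.mem_Iic.1 s.2).trans (min_le_left _ _))⟩ le_rfl) ?_
      rw [← (hmem x).2]
      exact le_iSup_of_le ⟨sInf (B x), le_min (hmem x).1 h⟩ le_rfl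
    · intro h
      obtain ⟨s, hs, h'⟩ := hM.exists_eq_cutValue hg (b := fun w => min w c)
        (fun w => min_le_left _ _) x
      have hsB : s ∈ B x := ⟨hs.trans (min_le_left _ _), h'.trans h⟩
      exact (csInf_le (OrderBot.bddBelow _) hsB).trans (hs.trans (min_le_right _ _))
  rw [this]
  exact measurableSet_eq_fun
    (hM.measurable_cutValue hg (by fun_prop) fun w => min_le_left _ _)
    (hM.measurable_cutValue hg continuous_id fun w => le_rfl)

theorem Admissible.rbar_eq (hM : M.Admissible) (x : ℝ≥0 × Z) : M.dp.rbar x = M.r x.1 0 := by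
  refine le_antisymm (iSup_le fun s => hM.r_anti _ _ _ bot_le s.2) ?_
  exact le_iSup_of_le (f := fun a : M.dp.Γ x => M.dp.r ⟨(x, a.1), a.2⟩)
    ⟨0, (bot_le : (0 : ℝ≥0) ≤ x.1)⟩ le_rfl

theorem Admissible.measurable_reward [SecondCountableTopology Z] [BorelSpace Z]
    (hM : M.Admissible) : Measurable M.dp.r := by
  let C : Set M.dp.D := {q | q.1.1.1 ∈ M.contSet}
  have hC : MeasurableSet C :=
    (measurable_fst.comp (measurable_fst.comp measurable_subtype_coe))
      M.isOpen_contSet.measurableSet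
  refine measurable_of_restrict_of_restrict_compl hC ?_ ?_
  · refine (hM.reward_continuousOn.comp_continuous (f := fun q : C => (q.1.1.1.1, q.1.1.2))
      (by fun_prop) fun q => ⟨q.1.2, q.2⟩).measurable
  · have : Cᶜ.domRestrict M.dp.r = fun _ => M.r 0 0 := by
      funext ⟨⟨⟨⟨w, z⟩, s⟩, hs⟩, hq⟩
      obtain rfl : w = 0 := eq_zero_of_notMem_contSet hq
      obtain rfl : s = 0 := le_antisymm hs bot_le
      rfl
    rw [this]
    exact measurable_const

theorem Admissible.measurable_zero_reward [SecondCountableTopology Z] [BorelSpace Z] (hM : M.Admissible) :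
    Measurable fun x : ℝ≥0 × Z => M.r x.1 0 := by
  have := hM.measurable_cutValue (g := fun _ => 0) (b := fun _ => 0) continuous_const
    continuous_const (fun w => bot_le)
  convert this using 1
  funext x
  refine le_antisymm (le_iSup_of_le ⟨0, Set.mem_Iic.2 le_rfl⟩ (by simp)) (iSup_le fun s => ?_)
  have hs : s.1 = 0 := le_antisymm (Set.mem_Iic.1 s.2) bot_le
  simp [hs]

end CutValue

end SavingsProblem

/-! ### Joint continuity of the expected continuation value. -/

namespace SavingsProblem

section Transition

variable {Z N E : Type*} [TopologicalSpace Z] [SecondCountableTopology Z]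
  [MeasurableSpace Z] [BorelSpace Z] [TopologicalSpace N]
  [TopologicalSpace E] [SecondCountableTopology E] [MeasurableSpace E] [BorelSpace E]
  {M : SavingsProblem Z N E} {κ : ℝ≥0 × Z → ℝ} {d α : ℝ}

theorem Admissible.transition_apply (hM : M.Admissible) (y : Z × ℝ≥0) :
    M.transition y = ((M.P y.1).prod M.φ).map (M.next y.2) := by
  have := hM.markov
  have := hM.prob
  have hm : Measurable fun u : ℝ≥0 × (Z × E) => (M.f (u.1, M.h u.2), u.2.1) :=
    hM.continuous_next.measurable
  rw [transition, Kernel.map_apply _ hm, Kernel.prod_apply,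
    Kernel.deterministic_apply, Kernel.comap_apply, Kernel.prod_apply, Kernel.const_apply,
    Measure.dirac_prod, Measure.map_map hm measurable_prodMk_left]
  rfl

theorem Admissible.isMarkovKernel (hM : M.Admissible) : IsMarkovKernel M.dp.Q := by
  have := hM.markov
  have := hM.prob
  refine ⟨fun q => ?_⟩
  change IsProbabilityMeasure (M.transition (q.1.1.2, q.1.2))
  rw [hM.transition_apply]
  exact Measure.isProbabilityMeasure_map (hM.continuous_next_right _).measurable.aemeasurable

theorem Admissible.expect_transition (hM : M.Admissible) (z : Z) (s : ℝ≥0) {v : ℝ≥0 × Z → EReal}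
    (hv : Measurable v) : expect (M.transition (z, s)) v =
      expect ((M.P z).prod M.φ) (fun u => v (M.next s u)) := by
  rw [hM.transition_apply, expect_map (hM.continuous_next_right s).measurable hv]

variable [TopologicalSpace.PseudoMetrizableSpace Z] {g : Z × ℝ≥0 → ℝ}

/-- The expected value of the next state is a jointly continuous function of the exogenous state
and savings. -/
theorem Admissible.continuous_expect_cutValue (hM : M.Admissible)
    (hκ : Continuous κ) (hκe : Continuous (M.kappaE κ)) (hκt : ∀ y, M.kappaE κ y ≠ ⊤)
    (hκ0 : ∀ x, 0 ≤ κ x) (hℓ : Continuous M.lowerEll) (hℓb : ∀ z, M.lowerEll z ≠ ⊥)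
    (hg : Continuous g) {c K : ℝ} (hK : 0 ≤ K) (hc : ∀ y, c ≤ g y)
    (hV : ∀ x, M.cutValue g id x ≤ ((K * κ x : ℝ) : EReal)) :
    Continuous (fun y => (expect (M.transition y) (M.cutValue g id)).toReal) ∧
      ∀ z, Monotone fun s => (expect (M.transition (z, s)) (M.cutValue g id)).toReal := by
  have := hM.markov
  have := hM.prob
  set V := M.cutValue g id with hVdef
  have hVm : Measurable V := hM.measurable_cutValue hg continuous_id fun w => le_rfl
  have hVc : ContinuousOn V (Prod.fst ⁻¹' M.contSet) :=
    hM.continuousOn_cutValue hg continuous_id fun w => le_rfl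
  have hVat : ∀ x : ℝ≥0 × Z, x.1 ∈ M.contSet → ContinuousAt V x := fun x hx =>
    hVc.continuousAt ((M.isOpen_contSet.preimage continuous_fst).mem_nhds hx)
  -- Shocks that lead into `contSet` even from zero savings; as `f` is increasing in savings, this
  -- one set serves every `s`.
  let O : Set (Z × E) := (fun u => (M.next 0 u).1) ⁻¹' M.contSet
  have hfc : Continuous fun u => (M.next 0 u).1 := continuous_fst.comp (hM.continuous_next_right 0)
  have hOopen : IsOpen O := M.isOpen_contSet.preimage hfc
  have hO : ∀ ε, IsOpen {z | (z, ε) ∈ O} := fun ε => hOopen.preimage (Continuous.prodMk_left ε)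
  have hOs : ∀ s u, u ∈ O → (M.next s u).1 ∈ M.contSet := fun s u hu =>
    contSet_mono hu (hM.next_fst_mono bot_le u)
  -- The lower envelope up to a constant. It does not depend on `s`, and its expectation is
  -- `lowerEll`.
  let L : Z × E → EReal := fun u => M.r (M.next 0 u).1 0
  have hLm : Measurable L :=
    hM.measurable_zero_reward.comp (hM.continuous_next_right 0).measurable
  have hLV : ∀ s u, L u + (c : EReal) ≤ V (M.next s u) := fun s u => by
    refine le_trans ?_ (le_cutValue hc _)
    gcongr
    exact hM.r_mono _ _ _ bot_le (hM.next_fst_mono bot_le u)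
  have hκE : ∀ z s, M.kappaE κ (z, s) =
      expect ((M.P z).prod M.φ) (fun u => (κ (M.next s u) : EReal)) := fun z s =>
    hM.expect_transition z s hκ.measurable.coe_real_ereal
  have hκb : ∀ z s, expect ((M.P z).prod M.φ) (fun u => (κ (M.next s u) : EReal)) ≠ ⊥ :=
    fun z s => by
      rw [expect_of_nonneg fun u => by exact_mod_cast hκ0 _]
      exact EReal.coe_ennreal_ne_bot _
  have hκi : ∀ z s, Integrable (fun u => κ (M.next s u)) ((M.P z).prod M.φ) := fun z s => by
    have := (integrable_toReal_of_expect_ne (μ := (M.P z).prod M.φ)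
      (u := fun u => (κ (M.next s u) : EReal))
      (hκ.comp (hM.continuous_next_right s)).measurable.coe_real_ereal.aemeasurable (hκb z s)
      (by rw [← hκE]; exact hκt _)).2
    simpa using this
  have hVK : ∀ s u, V (M.next s u) ≤ ((K * κ (M.next s u) : ℝ) : EReal) := fun s u => hV _
  have hLK : ∀ u, L u ≤ ((K * κ (M.next 0 u) - c : ℝ) : EReal) := fun u => by
    have h1 := (hLV 0 u).trans (hVK 0 u)
    rw [EReal.coe_sub]
    exact (EReal.le_sub_iff_add_le (Or.inl (EReal.coe_ne_bot _))
      (Or.inl (EReal.coe_ne_top _))).2 h1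
  have hLe : ∀ z, expect ((M.P z).prod M.φ) L = M.lowerEll z := fun z => rfl
  have hLce : ∀ z, expect ((M.P z).prod M.φ) (fun u => L u + (c : EReal)) =
      M.lowerEll z + (c : EReal) := fun z => by
    rw [DynProg.expect_add_coe (f := fun _ => c) hLm.aemeasurable
      (((hκi z 0).const_mul K).sub (integrable_const c)) hLK (integrable_const c), hLe]
    simp
  have hLcb : ∀ z, expect ((M.P z).prod M.φ) (fun u => L u + (c : EReal)) ≠ ⊥ := fun z => by
    rw [hLce]
    simp [EReal.add_eq_bot_iff, hℓb z]
  have hUe : ∀ z s, expect ((M.P z).prod M.φ) (fun u => ((K * κ (M.next s u) : ℝ) : EReal)) =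
      (K : EReal) * M.kappaE κ (z, s) := fun z s => by
    simp only [EReal.coe_mul]
    rw [expect_const_mul hK (fun u => (κ (M.next s u) : EReal))
      (hκ.comp (hM.continuous_next_right s)).measurable.coe_real_ereal.aemeasurable, hκE]
  have hUt : ∀ z s, expect ((M.P z).prod M.φ) (fun u => ((K * κ (M.next s u) : ℝ) : EReal)) ≠ ⊤ :=
    fun z s => by
      rw [expect_coe ((hκi z s).const_mul K)]; exact EReal.coe_ne_top _
  have hVT : ∀ z s, expect (M.transition (z, s)) V =
      expect ((M.P z).prod M.φ) (fun u => V (M.next s u)) := fun z s =>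
    hM.expect_transition z s hVm
  have hVb : ∀ z s, expect ((M.P z).prod M.φ) (fun u => V (M.next s u)) ≠ ⊥ := fun z s =>
    ne_bot_of_le_ne_bot (hLcb z) (expect_mono (hLV s))
  have hVt : ∀ z s, expect ((M.P z).prod M.φ) (fun u => V (M.next s u)) ≠ ⊤ := fun z s =>
    ne_top_of_le_ne_top (hUt z s) (expect_mono (hVK s))
  have hVsm : ∀ s, Measurable fun u => V (M.next s u) := fun s =>
    hVm.comp (hM.continuous_next_right s).measurable
  have hVmono : ∀ u, Monotone fun s => V (M.next s u) := fun u s s' hs =>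
    hM.cutValue_mono u.1 (hM.next_fst_mono hs u)
  have hLae : ∀ z, (∀ᵐ u ∂((M.P z).prod M.φ), ((L u).toReal : EReal) = L u) ∧
      Integrable (fun u => (L u).toReal) ((M.P z).prod M.φ) := fun z =>
    integrable_toReal_of_expect_ne hLm.aemeasurable (by rw [hLe]; exact hℓb z)
      (ne_top_of_le_ne_top (EReal.coe_ne_top _) ((expect_mono hLK).trans_eq
        (expect_coe (((hκi z 0).const_mul K).sub (integrable_const c)))))
  have hOae : ∀ z, ∀ᵐ u ∂((M.P z).prod M.φ), u ∈ O := fun z => by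
    filter_upwards [(hLae z).1] with u hu
    exact hM.mem_contSet_of_ne_bot (w := (M.next 0 u).1) fun h => by
      have : L u = ⊥ := h
      simp [this] at hu
  have hmono : ∀ z, Monotone fun s => (expect (M.transition (z, s)) V).toReal := by
    intro z s s' hs
    simp only [hVT]
    exact EReal.toReal_le_toReal (expect_mono fun u => hVmono u hs) (hVb z s) (hVt z s')
  refine ⟨continuous_of_monotone_of_separately hmono (fun s => ?_) (fun z => ?_), hmono⟩
  · -- continuity in the exogenous state
    simp only [hVT]
    have hsl : ∀ u : Z × E, Continuous fun z => M.next s (z, u.2) := fun u =>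
      (hM.continuous_next_right s).comp (Continuous.prodMk_left _)
    have hcont : Continuous fun z => expect ((M.P z).prod M.φ) (fun u => V (M.next s u)) := by
      refine feller_continuous_expect hM.feller (l := fun u => L u + (c : EReal))
        (w := fun u => ((K * κ (M.next s u) : ℝ) : EReal)) (hLm.add_const _) (hVsm s)
        ((hκ.comp (hM.continuous_next_right s)).measurable.const_mul K).coe_real_ereal
        (hLV s) (hVK s) hOopen.measurableSet hO hOae ?_ ?_ ?_ hLcb (fun z => hUt z s) ?_ ?_
      · intro u hu
        have h1 : ContinuousAt (fun z => L (z, u.2)) u.1 :=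
          (hM.continuousAt_zero_reward (w := (M.next 0 u).1) hu).comp
            (f := fun z => (M.next 0 (z, u.2)).1)
            (hfc.comp (Continuous.prodMk_left u.2)).continuousAt
        exact (EReal.continuousAt_add (p := (L u, (c : EReal))) (Or.inr (EReal.coe_ne_bot _))
          (Or.inr (EReal.coe_ne_top _))).comp (f := fun z => (L (z, u.2), (c : EReal)))
          (h1.prodMk continuousAt_const)
      · intro u hu
        exact (hVat (M.next s u) (hOs s u hu)).comp (f := fun z => M.next s (z, u.2))
          (hsl u).continuousAt
      · intro u _
        exact (continuous_coe_real_ereal.comp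
          ((hκ.comp (hsl u)).const_mul K)).continuousAt
      · simp only [hLce]
        exact hℓ.ereal_add_coe continuous_const
      · simp only [hUe]
        rw [continuous_iff_continuousAt]
        intro z
        exact EReal.Tendsto.const_mul ((hκe.comp (Continuous.prodMk_left s)).tendsto z)
          (Or.inl (EReal.coe_ne_bot _)) (Or.inl (EReal.coe_ne_top _))
    rw [continuous_iff_continuousAt]
    exact fun z => (EReal.tendsto_toReal (hVt z s) (hVb z s)).comp hcont.continuousAt
  · -- continuity in savings
    simp only [hVT]
    have hint : ∀ s, Integrable (fun u => (V (M.next s u)).toReal) ((M.P z).prod M.φ) := fun s =>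
      (integrable_toReal_of_expect_ne (hVsm s).aemeasurable (hVb z s) (hVt z s)).2
    have hval : ∀ s, (expect ((M.P z).prod M.φ) (fun u => V (M.next s u))).toReal =
        ∫ u, (V (M.next s u)).toReal ∂((M.P z).prod M.φ) := fun s => by
      rw [expect_eq_integral_toReal (hVsm s).aemeasurable (hVb z s) (hVt z s), EReal.toReal_coe]
    simp only [hval]
    have hbot : ∀ s u, ((L u).toReal : EReal) = L u → V (M.next s u) ≠ ⊥ := fun s u hu =>
      ne_bot_of_le_ne_bot (by rw [← hu, ← EReal.coe_add]; exact EReal.coe_ne_bot _) (hLV s u)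
    have htop : ∀ s u, V (M.next s u) ≠ ⊤ := fun s u =>
      ne_top_of_le_ne_top (EReal.coe_ne_top _) (hVK s u)
    rw [continuous_iff_continuousAt]
    intro s₀
    -- For `s ≤ s₀ + 1` the integrand lies between `L + c` and its own value at `s₀ + 1`, by
    -- monotonicity in savings.
    refine continuousAt_of_dominated (bound := fun u =>
      |(L u).toReal + c| + |(V (M.next (s₀ + 1) u)).toReal|)
      (Eventually.of_forall fun s => (hint s).1) ?_
      ((((hLae z).2.add (integrable_const c)).abs).add (hint (s₀ + 1)).abs) ?_
    · filter_upwards [Iic_mem_nhds (show s₀ < s₀ + 1 by simp)] with s hs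
      filter_upwards [(hLae z).1] with u hu
      have h1 : (L u).toReal + c ≤ (V (M.next s u)).toReal := by
        have := hLV s u
        rw [← hu, ← EReal.coe_add, ← EReal.coe_toReal (htop s u) (hbot s u hu)] at this
        exact_mod_cast this
      have h2 : (V (M.next s u)).toReal ≤ (V (M.next (s₀ + 1) u)).toReal :=
        EReal.toReal_le_toReal (hVmono u hs) (hbot s u hu) (htop _ u)
      rw [Real.norm_eq_abs, abs_le]
      constructor
      · linarith [neg_abs_le ((L u).toReal + c), abs_nonneg (V (M.next (s₀ + 1) u)).toReal]
      · linarith [abs_nonneg ((L u).toReal + c), le_abs_self (V (M.next (s₀ + 1) u)).toReal]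
    · filter_upwards [(hLae z).1, hOae z] with u hu huO
      refine (EReal.tendsto_toReal (htop s₀ u) (hbot s₀ u hu)).comp ?_
      exact (hVat (M.next s₀ u) (hOs s₀ u huO)).comp (f := fun s => M.next s u)
        (hM.continuous_next.comp (Continuous.prodMk_left u)).continuousAt

end Transition

end SavingsProblem

/-! ### The class `monoSpace`: closedness and invariance. -/

namespace SavingsProblem

section MonoSpace

variable {Z N E : Type*} [TopologicalSpace Z] [MeasurableSpace Z] [MeasurableSpace E]
  {M : SavingsProblem Z N E} {κ : ℝ≥0 × Z → ℝ} {d α : ℝ}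

/-- A continuous weight is locally bounded, so weighted convergence is locally uniform in `(z, s)`
and preserves continuity; monotonicity passes to pointwise limits. The function of `(z, s)` is read
off at the states with `w = s`. -/
theorem mem_monoSpace_of_tendsto (hκ : Continuous κ) (hκ1 : ∀ x, 1 ≤ κ x) {g : M.dp.D → ℝ}
    (hg : g ∈ M.dp.weightedSpace κ) {u : ℕ → M.dp.D → ℝ} (hu : ∀ n, u n ∈ M.monoSpace κ)
    (hlim : Tendsto (fun n => M.dp.wnorm κ (u n - g)) atTop (𝓝 0)) : g ∈ M.monoSpace κ := by
  have hclose : ∀ δ : ℝ, 0 < δ → ∀ᶠ n in atTop, ∀ q, |u n q - g q| ≤ δ * κ q.1.1 := by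
    intro δ hδ
    filter_upwards [hlim.eventually (ge_mem_nhds (ENNReal.ofReal_pos.2 hδ))] with n hn q
    exact DynProg.abs_le_of_wnorm_le hκ1 hδ.le hn q
  have hpt : ∀ q, Tendsto (fun n => u n q) atTop (𝓝 (g q)) := by
    intro q
    have hκq : 0 < κ q.1.1 := zero_lt_one.trans_le (hκ1 _)
    rw [Metric.tendsto_atTop']
    intro ε hε
    obtain ⟨n₀, hn₀⟩ := eventually_atTop.1 (hclose (ε / 2 / κ q.1.1) (by positivity))
    refine ⟨n₀, fun n hn => ?_⟩
    have := hn₀ n hn.le q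
    rw [div_mul_cancel₀ _ hκq.ne'] at this
    rw [Real.dist_eq]
    linarith
  choose _ g₀ hg₀c hg₀m hg₀ using hu
  have hpt₀ : ∀ y, Tendsto (fun n => g₀ n y) atTop (𝓝 (g (M.pairOf y.1 y.2))) := fun y => by
    have := hpt (M.pairOf y.1 y.2)
    simp only [hg₀] at this
    exact this
  refine ⟨hg, fun y => g (M.pairOf y.1 y.2), ?_, fun z s s' hs => ?_, fun q => ?_⟩
  · have hloc : TendstoLocallyUniformly g₀ (fun y => g (M.pairOf y.1 y.2)) atTop := by
      rw [Metric.tendstoLocallyUniformly_iff]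
      intro ε hε y
      have hκy : 0 < κ (y.2, y.1) + 1 := by linarith [hκ1 (y.2, y.1)]
      refine ⟨{y' | κ (y'.2, y'.1) < κ (y.2, y.1) + 1},
        (hκ.comp continuous_swap).continuousAt.eventually (gt_mem_nhds (lt_add_one _)), ?_⟩
      filter_upwards [hclose (ε / (κ (y.2, y.1) + 1)) (by positivity)] with n hn y' hy'
      have h1 := hn (M.pairOf y'.1 y'.2)
      rw [hg₀, abs_sub_comm] at h1
      rw [Real.dist_eq]
      refine h1.trans_lt ?_
      rw [div_mul_eq_mul_div, div_lt_iff₀ hκy]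
      exact mul_lt_mul_of_pos_left hy' hε
    exact hloc.continuous (Frequently.of_forall hg₀c)
  · exact le_of_tendsto_of_tendsto' (hpt₀ (z, s)) (hpt₀ (z, s')) fun n => hg₀m n z hs
  · have h1 := hpt q
    simp only [hg₀] at h1
    exact tendsto_nhds_unique h1 (hpt₀ (q.1.1.2, q.1.2))

theorem zero_mem_monoSpace : (fun _ => 0) ∈ M.monoSpace κ := by
  refine ⟨⟨measurable_const, ⟨0, fun _ => le_rfl⟩, ?_⟩, fun _ => 0, continuous_const,
    fun z => monotone_const, fun _ => rfl⟩
  simp [DynProg.wnorm]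

end MonoSpace

section Savings

variable {Z N E : Type*} [TopologicalSpace Z] [SecondCountableTopology Z]
  [MeasurableSpace Z] [BorelSpace Z] [TopologicalSpace N]
  [TopologicalSpace E] [MeasurableSpace E]
  {M : SavingsProblem Z N E} {κ : ℝ≥0 × Z → ℝ} {d α : ℝ}

theorem Admissible.measurable_maxValue (hM : M.Admissible) {g : M.dp.D → ℝ}
    (hg : g ∈ M.monoSpace κ) : Measurable (M.dp.maxValue g) := by
  obtain ⟨_, g₀, hc, _, h⟩ := hg
  rw [maxValue_eq_cutValue h]
  exact hM.measurable_cutValue hc continuous_id fun w => le_rfl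

theorem Admissible.exists_isGreedy (hM : M.Admissible) {g : M.dp.D → ℝ}
    (hg : g ∈ M.monoSpace κ) : ∃ σ : M.dp.Policy, M.dp.IsGreedy g σ := by
  obtain ⟨_, g₀, hc, _, h⟩ := hg
  obtain ⟨σ, hσ, hmax⟩ := hM.exists_measurable_argmax hc
  refine ⟨⟨σ, hσ, fun x => (hmax x).1⟩, fun x => ?_⟩
  rw [maxValue_eq_cutValue h, ← (hmax x).2, h]
  rfl

variable [SecondCountableTopology E] [BorelSpace E]

/-- The best reward `r w 0` increases with wealth, and any savings leave at least the wealth `f (0,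
η')`. -/
theorem Admissible.le_expect_rbar (hM : M.Admissible) {c : ℝ}
    (hc : ∀ z, (c : EReal) ≤ M.lowerEll z) (q : M.dp.D) :
    (c : EReal) ≤ expect (M.dp.Q q) M.dp.rbar := by
  have e : M.dp.rbar = fun x => M.r x.1 0 := funext hM.rbar_eq
  change (c : EReal) ≤ expect (M.transition (q.1.1.2, q.1.2)) _
  rw [e, hM.expect_transition _ _ hM.measurable_zero_reward]
  refine (hc q.1.1.2).trans (expect_mono fun u => ?_)
  exact hM.r_mono _ _ _ bot_le (hM.next_fst_mono bot_le u)

theorem Admissible.regular [TopologicalSpace.PseudoMetrizableSpace Z] [T2Space Z]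
    [StandardBorelSpace Z] (hM : M.Admissible) (hA : M.dp.GrowthCondition κ d α) {c : ℝ}
    (hc : ∀ z, (c : EReal) ≤ M.lowerEll z) : M.dp.Regular κ d α c where
  β_pos := hM.β_pos
  β_lt_one := hM.β_lt_one
  markov := hM.isMarkovKernel
  growth := hA
  measurable_r := hM.measurable_reward
  measurable_rbar := by
    rw [funext hM.rbar_eq]; exact hM.measurable_zero_reward
  le_expect_rbar := hM.le_expect_rbar hc
  aemeasurable_maxValue g hg μ hμ := by
    have hD : MeasurableSet {p : (ℝ≥0 × Z) × ℝ≥0 | p.2 ∈ feasible p.1} :=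
      measurableSet_le measurable_snd (measurable_fst.comp measurable_fst)
    -- The inner supremum runs over the fibres of the projection from state-action pairs to states,
    -- and a Borel subset of a standard Borel space is standard Borel.
    have : StandardBorelSpace M.dp.D := hD.standardBorel
    have h := aemeasurable_iSup_fiber (T := M.dp.D) (Y := ℝ≥0 × Z)
      (F := fun q => M.dp.r q + (g q : EReal)) (π := fun q => q.1.1)
      (hM.measurable_reward.add hg.coe_real_ereal)
      (measurable_fst.comp measurable_subtype_coe) μ
    convert h using 1
    funext x
    refine le_antisymm (iSup_le fun a => ?_) (iSup_le fun t => ?_)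
    · exact le_iSup_of_le (f := fun t : {t : M.dp.D // t.1.1 = x} =>
        M.dp.r t.1 + (g t.1 : EReal)) ⟨⟨(x, a.1), a.2⟩, rfl⟩ le_rfl
    · obtain ⟨t, rfl⟩ := t
      exact DynProg.r_add_le_maxValue g t

theorem Admissible.S_mem_monoSpace [TopologicalSpace.PseudoMetrizableSpace Z]
    (hM : M.Admissible) {c : ℝ}
    (hR : M.dp.Regular κ d α c) (hκ : Continuous κ) (hκe : Continuous (M.kappaE κ))
    (hℓ : Continuous M.lowerEll) (hℓb : ∀ z, (c : EReal) ≤ M.lowerEll z) {g : M.dp.D → ℝ}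
    (hg : g ∈ M.monoSpace κ) : M.dp.S g ∈ M.monoSpace κ := by
  have hmem := hR.S_mem hg.1 (hM.measurable_maxValue hg)
  obtain ⟨hgw, g₀, hgc, _, h⟩ := hg
  obtain ⟨b, K, hK, hb, hgK⟩ := hR.bounds hgw
  have hV := maxValue_eq_cutValue h
  obtain ⟨hcont, hmono⟩ := hM.continuous_expect_cutValue hκ hκe
    (fun y => ne_top_of_le_ne_top (EReal.coe_ne_top _) (hR.growth.expect_le (M.pairOf y.1 y.2)))
    (fun x => zero_le_one.trans (hR.growth.one_le x)) hℓ
    (fun z => ne_bot_of_le_ne_bot (EReal.coe_ne_bot _) (hℓb z)) hgc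
    (add_nonneg hR.growth.d_nonneg hK) (c := b)
    (fun y => (hb (M.pairOf y.1 y.2)).trans_eq (h _))
    (fun x => by
      rw [← hV]
      exact DynProg.maxValue_le hR.growth (fun q => (le_abs_self _).trans (hgK q)) x)
  refine ⟨hmem, fun y => M.β * (expect (M.transition y) (M.cutValue g₀ id)).toReal,
    hcont.const_mul _, fun z s s' hs => mul_le_mul_of_nonneg_left (hmono z hs) hM.β_pos.le,
    fun q => ?_⟩
  obtain ⟨h1, h2⟩ := hR.expect_maxValue_ne hgw q
  rw [(hR.coe_S h1 h2).2, hV]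
  rfl

end Savings

end SavingsProblem

/-! ### Assembly of the conclusions. -/

theorem proposition1 {m k : ℕ} (Z : Set (EuclideanSpace ℝ (Fin m)))
    (N : Set (EuclideanSpace ℝ (Fin k))) (hZ : MeasurableSet Z) (hN : MeasurableSet N)
    {E : Type*} [TopologicalSpace E] [SecondCountableTopology E] [MeasurableSpace E] [BorelSpace E]
    (M : SavingsProblem Z N E) (hM : M.Admissible)
    (κ : ℝ≥0 × Z → ℝ) (d α : ℝ) (hA : M.dp.GrowthCondition κ d α)
    (hκ : Continuous κ) (hκe : Continuous (M.kappaE κ))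
    (hℓ : Continuous M.lowerEll) (hℓb : ∃ c : ℝ, ∀ z, (c : EReal) ≤ M.lowerEll z) :
    -- the constrained function class is closed in the weighted space, contains greedy policies,
    -- and `S` is a contraction mapping on it
    (∀ g ∈ M.dp.weightedSpace κ, ∀ u : ℕ → M.dp.D → ℝ, (∀ n, u n ∈ M.monoSpace κ) →
      Tendsto (fun n => M.dp.wnorm κ (u n - g)) atTop (𝓝 0) → g ∈ M.monoSpace κ) ∧
    (∀ g ∈ M.monoSpace κ, ∃ σ : M.dp.Policy, M.dp.IsGreedy g σ) ∧
    (∀ g ∈ M.monoSpace κ, M.dp.S g ∈ M.monoSpace κ) ∧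
    α * M.β < 1 ∧
    -- `S` is well defined on the weighted space, preserves the bounds (and measurability, when
    -- the inner supremum is measurable), and is a contraction
    (∀ g ∈ M.dp.weightedSpace κ,
      (∀ q, (M.dp.S g q : EReal) = M.dp.SE g q) ∧
      (∃ c : ℝ, ∀ q, c ≤ M.dp.S g q) ∧
      M.dp.wnorm κ (M.dp.S g) < ∞ ∧
      (∀ ρ : Measure M.dp.D, IsFiniteMeasure ρ → AEMeasurable (M.dp.S g) ρ) ∧
      (Measurable (M.dp.maxValue g) → M.dp.S g ∈ M.dp.weightedSpace κ)) ∧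
    (∀ g₁ ∈ M.dp.weightedSpace κ, ∀ g₂ ∈ M.dp.weightedSpace κ,
      M.dp.wnorm κ (M.dp.S g₁ - M.dp.S g₂) ≤
        ENNReal.ofReal (α * M.β) * M.dp.wnorm κ (g₁ - g₂)) ∧
    -- the series that defines the value of a policy converges in `[-∞, ∞)`
    (∀ (σ : M.dp.Policy) (x : ℝ≥0 × Z),
      Tendsto (M.dp.partialValue σ x) atTop (𝓝 (M.dp.policyValue σ x)) ∧
        M.dp.policyValue σ x < ⊤) ∧
    -- unique fixed point, rate of convergence, optimality
    ∃ gs ∈ M.monoSpace κ,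
      M.dp.S gs = gs ∧
      (∀ g ∈ M.dp.weightedSpace κ, M.dp.S g = g → g = gs) ∧
      (∀ g ∈ M.dp.weightedSpace κ, ∃ C : ℝ≥0, ∀ n : ℕ,
        M.dp.wnorm κ (M.dp.S^[n] g - gs) ≤ C * ENNReal.ofReal ((α * M.β) ^ n)) ∧
      (∀ q : M.dp.D, (gs q : EReal) = (M.β : EReal) * expect (M.dp.Q q) M.dp.value) ∧
      (∀ x : ℝ≥0 × Z, IsGreatest
        (Set.range fun a : M.dp.Γ x =>
          M.dp.r ⟨(x, a.1), a.2⟩ + (gs ⟨(x, a.1), a.2⟩ : EReal)) (M.dp.value x)) ∧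
      (∃ σ : M.dp.Policy, M.dp.IsOptimal σ) ∧
      (∀ σ : M.dp.Policy, M.dp.IsOptimal σ ↔ M.dp.IsGreedy gs σ) := by
  have : StandardBorelSpace Z := hZ.standardBorel
  obtain ⟨c, hc⟩ := hℓb
  have hR := hM.regular hA hc
  have hclosed : ∀ g ∈ M.dp.weightedSpace κ, ∀ u : ℕ → M.dp.D → ℝ, (∀ n, u n ∈ M.monoSpace κ) →
      Tendsto (fun n => M.dp.wnorm κ (u n - g)) atTop (𝓝 0) → g ∈ M.monoSpace κ :=
    fun g hg u hu hlim => SavingsProblem.mem_monoSpace_of_tendsto hκ hA.one_le hg hu hlim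
  have hS : ∀ g ∈ M.monoSpace κ, M.dp.S g ∈ M.monoSpace κ := fun g hg =>
    hM.S_mem_monoSpace hR hκ hκe hℓ hc hg
  obtain ⟨gs, hgs, hfix⟩ := hR.exists_fixed (G := M.monoSpace κ) (fun g hg => hg.1) hclosed hS
    SavingsProblem.zero_mem_monoSpace
  have hm := hM.measurable_maxValue hgs
  obtain ⟨σ, hσ⟩ := hM.exists_isGreedy hgs
  refine ⟨hclosed, fun g hg => hM.exists_isGreedy hg, hS, hR.mul_lt_one, fun g hg => ⟨fun q => ?_,
    hR.exists_le_S hg, hR.wnorm_S_lt_top hg, fun ρ hρ => hR.aemeasurable_S hg.1 ρ, hR.S_mem hg⟩,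
    fun g₁ hg₁ g₂ hg₂ => hR.wnorm_S_sub_le hg₁ (hR.wnorm_sub_lt_top hg₁.2.2 hg₂.2.2),
    hR.tendsto_partialValue, gs, hgs, hfix, fun g hg hg' => hR.eq_of_fixed hgs.1 hfix hg hg',
    fun g hg => ?_, fun q => ?_, hR.isGreatest_value hgs.1 hfix hm hσ,
    ⟨σ, (hR.isOptimal_iff_isGreedy hgs.1 hfix hm hσ σ).2 hσ⟩,
    hR.isOptimal_iff_isGreedy hgs.1 hfix hm hσ⟩
  · obtain ⟨h1, h2⟩ := hR.expect_maxValue_ne hg q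
    exact (hR.coe_S h1 h2).1
  · have hlt := hR.wnorm_sub_lt_top hgs.1.2.2 hg.2.2
    -- The constant is the initial distance to the fixed point.
    refine ⟨(M.dp.wnorm κ (gs - g)).toNNReal, fun n => ?_⟩
    have hle := hR.wnorm_iterate_sub_le (g := g) hgs.1 hfix ENNReal.toReal_nonneg
      (fun q => by simpa using DynProg.abs_le_toReal_wnorm hA.one_le hlt q) n
    rw [ENNReal.coe_toNNReal hlt.ne, ← ENNReal.ofReal_toReal hlt.ne,
      ← ENNReal.ofReal_mul ENNReal.toReal_nonneg]
    exact DynProg.wnorm_le_ofReal hA.one_le fun q => by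
      rw [Pi.sub_apply, abs_sub_comm]; exact hle q
  · rw [hR.value_eq hgs.1 hfix hm hσ]
    exact hR.coe_fixed hgs.1 hfix q
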